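/- Let $q$ be a prime power and let $b>1$ and $d$ be integers such that $b\mid d$ and $d/b\ge 4$ is even. Let $V'=\mathbb F_{q^b}^{d/b}$ and let $$Q'(x)=x_1x_2+x_3x_4+\cdots+x_{d/b-3}x_{d/b-2}+x_{d/b-1}^2+a_0x_{d/b-1}x_{d/b}+a_1x_{d/b}^2,$$ where $a_0,a_1\in\mathbb F_{q^b}$ are such that $X^2+a_0X+a_1$ is irreducible over $\mathbb F_{q^b}$. Regard $V'$ as a $d$-dimensional vector space $V$ over $\mathbb F_q$ with the quadratic form $Q=\mathrm{Tr}_{q^b/q}\circ Q'$, and let $Q^-(d-1,q)$ be the polar space of $Q$: its points are the one-dimensional totally singular $\mathbb F_q$-subspaces of $V$, and its generators are the maximal totally singular $\mathbb F_q$-subspaces of $V$. An $m$-ovoid of it is a set of points that meets every generator in exactly $m$ points. Let $\square$ be the set of nonzero squares of $\mathbb F_q$, let $\mathcal T$ be a nonempty subset of $\mathbb F_{q^b}^*$ that is invariant under multiplication by $\square$ and all of whose elements have relative trace $0$ to $\mathbb F_q$, and let $T$ be a set of representatives of the $\square$-cosets contained in $\mathcal T$, so that $\mathcal T=\square\cdot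 T$. Put $\mathcal M=\{\langle v\rangle_{\mathbb F_q} : v \in V,\ Q'(v)\in\mathcal T\}$, and let $\epsilon=\tfrac12$ if $q$ is odd and $\epsilon=1$ if $q$ is even. If $\mathcal M$ is an $\epsilon|T|q^{d/2-b}$-ovoid of $Q^-(d-1,q)$, then $$|T|\ge\frac{q^b}{\epsilon(q-1)(2q^{b/2}+1)}.$$ -/

import Mathlib

/-- A subspace is totally singular for the quadratic form `Q` if `Q` vanishes on it. -/
def TotallySingular {F V : Type*} [Field F] [AddCommGroup V] [Module F V]
    (Q : QuadraticForm F V) (W : Submodule F V) : Prop :=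
  ∀ w ∈ W, Q w = 0

/-- The points of the polar space of `Q`: the one-dimensional totally singular subspaces. -/
def polarPoints {F V : Type*} [Field F] [AddCommGroup V] [Module F V]
    (Q : QuadraticForm F V) : Set (Submodule F V) :=
  {P | Module.finrank F P = 1 ∧ TotallySingular Q P}

/-- The generators of the polar space of `Q`: the maximal totally singular subspaces. -/
def IsGenerator {F V : Type*} [Field F] [AddCommGroup V] [Module F V]
    (Q : QuadraticForm F V) (W : Submodule F V) : Prop :=
  Maximal (TotallySingular Q) W

/-- An `m`-ovoid of the polar space of `Q`: a set of points of the polar space that meets each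
generator in exactly `m` points. -/
def IsMOvoid {F V : Type*} [Field F] [AddCommGroup V] [Module F V]
    (Q : QuadraticForm F V) (m : ℕ) (M : Set (Submodule F V)) : Prop :=
  M ⊆ polarPoints Q ∧ ∀ W, IsGenerator Q W → {P ∈ M | P ≤ W}.encard = m

/-- The quadratic form
`x₁x₂ + x₃x₄ + ⋯ + x₂ₖ₋₁x₂ₖ + x₂ₖ₊₁² + a₀ x₂ₖ₊₁x₂ₖ₊₂ + a₁ x₂ₖ₊₂²` on `E^(2k+2)`
(the coordinates are numbered from `0` in the code). -/
noncomputable def ellipticForm (E : Type*) [Field E] (k : ℕ) (a₀ a₁ : E) :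
    QuadraticForm E (Fin (2 * k + 2) → E) :=
  (∑ i : Fin k, QuadraticMap.proj (R := E) (A := E)
      (⟨2 * i, by omega⟩ : Fin (2 * k + 2)) ⟨2 * i + 1, by omega⟩)
    + QuadraticMap.proj (R := E) (A := E)
        (⟨2 * k, by omega⟩ : Fin (2 * k + 2)) ⟨2 * k, by omega⟩
    + a₀ • QuadraticMap.proj (R := E) (A := E)
        (⟨2 * k, by omega⟩ : Fin (2 * k + 2)) ⟨2 * k + 1, by omega⟩
    + a₁ • QuadraticMap.proj (R := E) (A := E)
        (⟨2 * k + 1, by omega⟩ : Fin (2 * k + 2)) ⟨2 * k + 1, by omega⟩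

theorem ellipticForm_apply (E : Type*) [Field E] (k : ℕ) (a₀ a₁ : E)
    (x : Fin (2 * k + 2) → E) :
    ellipticForm E k a₀ a₁ x =
      (∑ i : Fin k, x ⟨2 * i, by omega⟩ * x ⟨2 * i + 1, by omega⟩)
        + x ⟨2 * k, by omega⟩ ^ 2
        + a₀ * x ⟨2 * k, by omega⟩ * x ⟨2 * k + 1, by omega⟩
        + a₁ * x ⟨2 * k + 1, by omega⟩ ^ 2 := by
  simp [ellipticForm, sq, mul_assoc]

/-- The form `Tr_{E/F} ∘ Q'`, a quadratic form on the vector space `V'` regarded over `F`. -/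
noncomputable def traceForm (F : Type*) {E V' : Type*} [Field F] [Field E] [Algebra F E]
    [AddCommGroup V'] [Module E V'] [Module F V'] [IsScalarTower F E V']
    (Q' : QuadraticForm E V') : QuadraticForm F V' :=
  (Algebra.trace F E).compQuadraticMap' Q'

theorem traceForm_apply (F : Type*) {E V' : Type*} [Field F] [Field E] [Algebra F E]
    [AddCommGroup V'] [Module E V'] [Module F V'] [IsScalarTower F E V']
    (Q' : QuadraticForm E V') (x : V') : traceForm F Q' x = Algebra.trace F E (Q' x) := rfl

/-- The set of nonzero squares of a field. -/
def nonzeroSquares (F : Type*) [Field F] : Set F := {c | c ≠ 0 ∧ IsSquare c}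

/-- `T` is a set of representatives of the cosets, modulo the nonzero squares of `F`, that make
up `S`. -/
def IsSquareCosetReps (F : Type*) {E : Type*} [Field F] [Field E] [Algebra F E]
    (S : Set E) (T : Finset E) : Prop :=
  (T : Set E) ⊆ S ∧ ∀ x ∈ S, ∃! t, t ∈ T ∧ ∃ c ∈ nonzeroSquares F, x = c • t

/-- The set of `F`-points `⟨v⟩` with `Q' v ∈ S`. -/
def pointsWithValueIn (F : Type*) {E V' : Type*} [Field F] [Field E]
    [AddCommGroup V'] [Module E V'] [Module F V']
    (Q' : QuadraticForm E V') (S : Set E) : Set (Submodule F V') :=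
  {P | ∃ v : V', v ≠ 0 ∧ Q' v ∈ S ∧ P = Submodule.span F {v}}

/-- `1/2` or `1` according as `q` is odd or even. -/
noncomputable def parityFactor (q : ℕ) : ℝ := if Odd q then 1 / 2 else 1

/-!
Fix a nontrivial additive character of `F`, lifted to `E` through the trace. The Fourier transform
of the indicator function of `{x | Q' x ∈ S}`, at a vector `v` of this set, is computed in two ways.
Counting the points of the `m`-ovoid in the residues of the polar space, it is
`(q - 1) * m - |E| ^ (k + 1)` if `Q'` has `2 * k + 2` variables. Slicing the set by the values of
`Q'`, it is `-|E| ^ k` times the sum over `c ∈ S` of the Kloosterman sums `K(Q' v * c)`, each of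
absolute value at most `2 * √|E|` by Weil's bound. As `m` and `|S|` are proportional to `|T|`, the
comparison bounds `|T|` from below.

Weil's bound itself comes from Stepanov's polynomial method, which bounds the number of solutions of
`Tr (x + a / x) = s` over fields of even degree and yields `|K(a)| ≤ (2 + δ) * √|E|`. In a quadratic
extension `L` one has `K(a) ^ 2 + K_L(a) = 2 * |E|`, so a bound with error `δ` over `L` gives one
with error `δ / 4` over `E`, and a tower of such extensions brings the error down to `0`.
-/

section QuadraticExtension

theorem eq_or_eq_swap_of_add_eq_of_mul_eq {R : Type*} [CommRing R] [IsDomain R] {x y : R × R}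
    (hadd : x.1 + x.2 = y.1 + y.2) (hmul : x.1 * x.2 = y.1 * y.2) : x = y ∨ x = y.swap := by
  have hroot : (x.1 - y.1) * (x.1 - y.2) = 0 := by linear_combination x.1 * hadd - hmul
  refine (mul_eq_zero.mp hroot).imp (fun h => ?_) fun h => ?_
  · exact Prod.ext (sub_eq_zero.mp h) (by linear_combination hadd - h)
  · exact Prod.ext (sub_eq_zero.mp h) (by rw [Prod.snd_swap]; linear_combination hadd - h)

theorem card_le_two_of_add_eq_of_mul_eq {R : Type*} [CommRing R] [IsDomain R] {s p : R}
    {A : Finset (R × R)} (hA : ∀ x ∈ A, x.1 + x.2 = s ∧ x.1 * x.2 = p) : A.card ≤ 2 := by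
  classical
  rcases A.eq_empty_or_nonempty with rfl | ⟨y, hy⟩
  · simp
  refine (Finset.card_le_card (t := {y, y.swap}) fun x hx => ?_).trans Finset.card_le_two
  rw [Finset.mem_insert, Finset.mem_singleton]
  exact eq_or_eq_swap_of_add_eq_of_mul_eq ((hA x hx).1.trans (hA y hy).1.symm)
    ((hA x hx).2.trans (hA y hy).2.symm)

theorem card_add_card_le_two_of_add_eq_of_mul_eq {R : Type*} [CommRing R] [IsDomain R] {s p : R}
    {A B : Finset (R × R)} (hA : ∀ x ∈ A, x.1 + x.2 = s ∧ x.1 * x.2 = p)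
    (hB : ∀ x ∈ B, x.1 + x.2 = s ∧ x.1 * x.2 = p) (hAB : ∀ x ∈ A, x ∈ B → x = x.swap) :
    A.card + B.card ≤ 2 := by
  classical
  by_cases hdisj : Disjoint A B
  · rw [← Finset.card_union_of_disjoint hdisj]
    exact card_le_two_of_add_eq_of_mul_eq (s := s) (p := p) fun x hx =>
      (Finset.mem_union.mp hx).elim (hA x) (hB x)
  · obtain ⟨w, hwA, hwB⟩ := Finset.not_disjoint_iff.mp hdisj
    have huniq (u : R × R) (hu : u.1 + u.2 = s ∧ u.1 * u.2 = p) : u = w :=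
      (eq_or_eq_swap_of_add_eq_of_mul_eq (hu.1.trans (hA w hwA).1.symm)
        (hu.2.trans (hA w hwA).2.symm)).elim id fun h => h.trans (hAB w hwA hwB).symm
    have hA1 : A.card ≤ 1 := Finset.card_le_one_iff_subset_singleton.mpr
      ⟨w, fun u hu => Finset.mem_singleton.mpr (huniq u (hA u hu))⟩
    have hB1 : B.card ≤ 1 := Finset.card_le_one_iff_subset_singleton.mpr
      ⟨w, fun u hu => Finset.mem_singleton.mpr (huniq u (hB u hu))⟩
    omega

variable {E L : Type*} [Field E] [Fintype E] [Field L] [Algebra E L]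

theorem algebraMap_trace_of_finrank_eq_two [Finite L] (h : Module.finrank E L = 2) (z : L) :
    algebraMap E L (Algebra.trace E L z) = z + z ^ Fintype.card E := by
  rw [FiniteField.algebraMap_trace_eq_sum_pow, h]
  simp [Finset.sum_range_succ]

theorem algebraMap_norm_of_finrank_eq_two [Finite L] (h : Module.finrank E L = 2) (z : L) :
    algebraMap E L (Algebra.norm E z) = z * z ^ Fintype.card E := by
  rw [FiniteField.algebraMap_norm_eq_prod_pow, h]
  simp [Finset.prod_range_succ]

variable [Fintype L]

theorem card_add_mul_add_card_trace_norm_le_two [DecidableEq E]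
    (h : Module.finrank E L = 2) (s p : E) :
    (Finset.univ.filter fun x : E × E => (x.1 + x.2, x.1 * x.2) = (s, p)).card +
      (Finset.univ.filter fun z : L => (Algebra.trace E L z, Algebra.norm E z) = (s, p)).card
      ≤ 2 := by
  classical
  let ι := algebraMap E L
  set A := Finset.univ.filter fun x : E × E => (x.1 + x.2, x.1 * x.2) = (s, p)
  set B := Finset.univ.filter fun z : L => (Algebra.trace E L z, Algebra.norm E z) = (s, p)
  have hA : (A.image (Prod.map ι ι)).card = A.card :=
    Finset.card_image_of_injective _ (ι.injective.prodMap ι.injective)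
  have hB : (B.image fun z => (z, z ^ Fintype.card E)).card = B.card :=
    Finset.card_image_of_injective _ fun z w hzw => congrArg Prod.fst hzw
  rw [← hA, ← hB]
  refine card_add_card_le_two_of_add_eq_of_mul_eq (s := ι s) (p := ι p)
    (Finset.forall_mem_image.mpr fun x hx => ?_) (Finset.forall_mem_image.mpr fun z hz => ?_)
    (Finset.forall_mem_image.mpr fun x _ hxB => ?_)
  · obtain ⟨hs, hp⟩ := Prod.mk.inj (Finset.mem_filter.mp hx).2
    simp [← hs, ← hp]
  · obtain ⟨hs, hp⟩ := Prod.mk.inj (Finset.mem_filter.mp hz).2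
    rw [← hs, ← hp]
    exact ⟨(algebraMap_trace_of_finrank_eq_two h z).symm,
      (algebraMap_norm_of_finrank_eq_two h z).symm⟩
  · -- A pair `(z, z ^ |E|)` with `z` in `E` is diagonal.
    obtain ⟨z, -, hz⟩ := Finset.mem_image.mp hxB
    have hfst : ι x.1 = z := congrArg Prod.fst hz.symm
    rw [← hz, ← hfst, ← map_pow, FiniteField.pow_card]
    rfl

theorem card_add_mul_add_card_trace_norm [DecidableEq E] (h : Module.finrank E L = 2) (s p : E) :
    (Finset.univ.filter fun x : E × E => (x.1 + x.2, x.1 * x.2) = (s, p)).card +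
      (Finset.univ.filter fun z : L => (Algebra.trace E L z, Algebra.norm E z) = (s, p)).card
      = 2 := by
  have htotal : ∑ w : E × E,
      ((Finset.univ.filter fun x : E × E => (x.1 + x.2, x.1 * x.2) = w).card +
        (Finset.univ.filter fun z : L => (Algebra.trace E L z, Algebra.norm E z) = w).card) =
      ∑ _w : E × E, 2 := by
    rw [Finset.sum_add_distrib, ← Finset.card_eq_sum_card_fiberwise fun _ _ => Finset.mem_univ _,
      ← Finset.card_eq_sum_card_fiberwise fun _ _ => Finset.mem_univ _]
    simp only [Finset.card_univ, Finset.sum_const, Fintype.card_prod, smul_eq_mul,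
      Module.card_eq_pow_finrank (K := E) (V := L), h]
    ring
  exact (Finset.sum_eq_sum_iff_of_le fun w _ =>
    card_add_mul_add_card_trace_norm_le_two h w.1 w.2).mp htotal (s, p) (Finset.mem_univ _)

theorem sum_add_mul_add_sum_trace_norm {M : Type*} [AddCommMonoid M]
    (h : Module.finrank E L = 2) (φ : E → E → M) :
    (∑ x : E, ∑ y : E, φ (x + y) (x * y)) +
      ∑ z : L, φ (Algebra.trace E L z) (Algebra.norm E z) = 2 • ∑ s : E, ∑ p : E, φ s p := by
  classical
  rw [← Fintype.sum_prod_type' fun x y => φ (x + y) (x * y), ← Fintype.sum_prod_type',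
    ← Finset.sum_fiberwise' Finset.univ (fun x : E × E => (x.1 + x.2, x.1 * x.2))
      fun w => φ w.1 w.2,
    ← Finset.sum_fiberwise' Finset.univ (fun z : L => (Algebra.trace E L z, Algebra.norm E z))
      fun w => φ w.1 w.2,
    ← Finset.sum_add_distrib, Finset.smul_sum]
  refine Finset.sum_congr rfl fun w _ => ?_
  rw [Finset.sum_const, Finset.sum_const, ← add_smul, card_add_mul_add_card_trace_norm h w.1 w.2]

end QuadraticExtension

section Kloosterman

variable {E L : Type*} [Field E] [Field L] [Algebra E L]

/-- The lift `ψ ∘ Tr_{L/E}` to an extension `L` of an additive character `ψ` of `E`. -/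
noncomputable def traceLift (L : Type*) [Field L] [Algebra E L] (ψ : AddChar E ℂ) :
    AddChar L ℂ :=
  ψ.compAddMonoidHom (Algebra.trace E L).toAddMonoidHom

theorem traceLift_apply (ψ : AddChar E ℂ) (x : L) :
    traceLift L ψ x = ψ (Algebra.trace E L x) := rfl

theorem traceLift_traceLift {F : Type*} [Field F] [Algebra F E] [Algebra F L]
    [IsScalarTower F E L] [Module.Finite F E] [Module.Finite E L] (ψ : AddChar F ℂ) :
    traceLift L (traceLift E ψ) = traceLift L ψ := by
  ext x
  rw [traceLift_apply, traceLift_apply, traceLift_apply, Algebra.trace_trace]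

theorem traceLift_ne_one [Finite E] [Finite L] {ψ : AddChar E ℂ} (hψ : ψ ≠ 1) :
    traceLift L ψ ≠ 1 := by
  obtain ⟨x, hx⟩ := AddChar.ne_one_iff.mp hψ
  obtain ⟨y, rfl⟩ := Algebra.trace_surjective E L x
  exact AddChar.ne_one_iff.mpr ⟨y, hx⟩

theorem trace_add_algebraMap_div [Finite E] [Finite L] (h : Module.finrank E L = 2) {z : L}
    (hz : z ≠ 0) (a : E) :
    Algebra.trace E L (z + algebraMap E L a / z) =
      Algebra.trace E L z * (1 + a / Algebra.norm E z) := by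
  cases nonempty_fintype E
  have hfrob : (z + algebraMap E L a / z) ^ Fintype.card E =
      z ^ Fintype.card E + algebraMap E L a / z ^ Fintype.card E := by
    simpa only [FiniteField.coe_frobeniusAlgHom, AlgHom.commutes] using
      (map_add (FiniteField.frobeniusAlgHom E L) z (algebraMap E L a / z)).trans
        (congrArg _ (map_div₀ (FiniteField.frobeniusAlgHom E L) (algebraMap E L a) z))
  apply (algebraMap E L).injective
  rw [algebraMap_trace_of_finrank_eq_two h, map_mul, map_add, map_div₀, map_one,
    algebraMap_trace_of_finrank_eq_two h, algebraMap_norm_of_finrank_eq_two h, hfrob]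
  field_simp
  ring

variable [Fintype E]

open Classical in
/-- The Kloosterman sum of parameter `a` attached to an additive character of a finite field. -/
noncomputable def kloosterman (ψ : AddChar E ℂ) (a : E) : ℂ :=
  ∑ x with x ≠ 0, ψ (x + a / x)

theorem kloosterman_eq_sum_ite [DecidableEq E] (ψ : AddChar E ℂ) (a : E) :
    kloosterman ψ a = ∑ x, if x = 0 then 0 else ψ (x + a / x) := by
  rw [kloosterman, Finset.sum_filter]
  exact Finset.sum_congr rfl fun x _ => by rw [ite_not]; congr

theorem sum_addChar_mul_eq_ite {ψ : AddChar E ℂ} (hψ : ψ ≠ 1) [DecidableEq E] (b : E) :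
    ∑ x : E, ψ (x * b) = if b = 0 then (Fintype.card E : ℂ) else 0 := by
  rw [AddChar.sum_mulShift b (AddChar.IsPrimitive.of_ne_one hψ)]
  split_ifs <;> simp

variable [Fintype L]

theorem kloosterman_sq_add_kloosterman_traceLift (h : Module.finrank E L = 2)
    {ψ : AddChar E ℂ} (hψ : ψ ≠ 1) {a : E} (ha : a ≠ 0) :
    kloosterman ψ a ^ 2 + kloosterman (traceLift L ψ) (algebraMap E L a) =
      2 * Fintype.card E := by
  classical
  let φ : E → E → ℂ := fun s p => if p = 0 then 0 else ψ (s * (1 + a / p))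
  have hpairs : kloosterman ψ a ^ 2 = ∑ x : E, ∑ y : E, φ (x + y) (x * y) := by
    rw [kloosterman_eq_sum_ite, sq, Finset.sum_mul_sum]
    refine Finset.sum_congr rfl fun x _ => Finset.sum_congr rfl fun y _ => ?_
    by_cases hx : x = 0
    · simp [φ, hx]
    by_cases hy : y = 0
    · simp [φ, hy]
    simp only [φ, hx, hy, mul_eq_zero, or_self, if_false, ← AddChar.map_add_eq_mul]
    congr 1
    field_simp
    ring
  have hlift : kloosterman (traceLift L ψ) (algebraMap E L a) =
      ∑ z : L, φ (Algebra.trace E L z) (Algebra.norm E z) := by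
    rw [kloosterman_eq_sum_ite]
    refine Finset.sum_congr rfl fun z _ => ?_
    by_cases hz : z = 0
    · simp [φ, hz]
    simp only [φ, hz, Algebra.norm_eq_zero_iff, if_false, traceLift_apply,
      trace_add_algebraMap_div h hz]
  have hinner (p : E) : ∑ s : E, φ s p = if p = -a then (Fintype.card E : ℂ) else 0 := by
    by_cases hp : p = 0
    · simp [φ, hp, eq_comm (a := (0 : E)), ha]
    have hroot : 1 + a / p = 0 ↔ p = -a := by
      rw [add_comm, ← neg_eq_iff_add_eq_zero, ← neg_div, div_eq_one_iff_eq hp, eq_comm]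
    simp only [φ, hp, if_false, sum_addChar_mul_eq_ite hψ, hroot]
  rw [hpairs, hlift, sum_add_mul_add_sum_trace_norm h φ, Finset.sum_comm, nsmul_eq_mul]
  simp [hinner]

end Kloosterman

section Stepanov

open Polynomial

theorem linearIndependent_of_natDegree_injective {K ι : Type*} [Field K] [Finite ι]
    {P : ι → K[X]} (hP : ∀ i, P i ≠ 0) (hinj : Function.Injective fun i => (P i).natDegree) :
    LinearIndependent K P := by
  classical
  cases nonempty_fintype ι
  rw [Fintype.linearIndependent_iff]
  by_contra! ⟨c, hsum, i₁, hi₁⟩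
  obtain ⟨i₀, hi₀, hmax⟩ := Finset.exists_max_image (Finset.univ.filter fun i => c i ≠ 0)
    (fun i => (P i).natDegree) ⟨i₁, (Finset.mem_filter_univ _).mpr hi₁⟩
  rw [Finset.mem_filter_univ] at hi₀
  have htop : (∑ i, c i • P i).coeff (P i₀).natDegree = c i₀ * (P i₀).leadingCoeff := by
    rw [finsetSum_coeff, Finset.sum_eq_single i₀ (fun i _ hi => ?_) (by simp), coeff_smul,
      smul_eq_mul, coeff_natDegree]
    by_cases hci : c i = 0
    · simp [hci]
    have hlt : (P i).natDegree < (P i₀).natDegree :=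
      (hmax i ((Finset.mem_filter_univ _).mpr hci)).lt_of_ne fun h => hi (hinj h)
    rw [coeff_smul, coeff_eq_zero_of_natDegree_lt hlt, smul_zero]
  rw [hsum, coeff_zero] at htop
  exact mul_ne_zero hi₀ (leadingCoeff_ne_zero.mpr (hP i₀)) htop.symm

theorem not_linearIndependent_of_natDegree_lt {K ι : Type*} [Field K] [Fintype ι] {T : ι → K[X]}
    {D : ℕ} (hT : ∀ i, (T i).natDegree < D) (hD : D < Fintype.card ι) :
    ¬ LinearIndependent K T := by
  intro hli
  have hmem (i : ι) : T i ∈ degreeLT K D :=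
    mem_degreeLT.mpr (degree_le_natDegree.trans_lt (Nat.cast_lt.mpr (hT i)))
  let T' (i : ι) : degreeLT K D := ⟨T i, hmem i⟩
  have hli' : LinearIndependent K T' := LinearIndependent.of_comp (degreeLT K D).subtype hli
  have hle := hli'.fintype_card_le_finrank
  rw [Module.finrank_eq_card_basis (degreeLT.basis K D), Fintype.card_fin] at hle
  omega

/-- A linear relation among the `T i` is turned by `σ` into a nonzero polynomial vanishing
on `Z`. -/
theorem card_le_of_involutive_map_eval {E ι : Type*} [Field E] [Fintype ι] {σ : E →+* E}
    (hσ : Function.Involutive σ) {P T : ι → E[X]} {M D : ℕ} (hP : ∀ i, P i ≠ 0)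
    (hPinj : Function.Injective fun i => (P i).natDegree) (hPdeg : ∀ i, (P i).natDegree ≤ M)
    (hTdeg : ∀ i, (T i).natDegree < D) (hD : D < Fintype.card ι) (Z : Finset E)
    (hZ : ∀ x ∈ Z, ∃ α ≠ 0, ∃ β, ∀ i, α * σ ((P i).eval x) = β * (T i).eval x) :
    Z.card ≤ M := by
  obtain ⟨c, hc, i, hi⟩ :=
    Fintype.not_linearIndependent_iff.mp (not_linearIndependent_of_natDegree_lt hTdeg hD)
  set W := ∑ i, σ (c i) • P i
  have hW : W ≠ 0 := fun h => hi <| (map_eq_zero σ).mp <|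
    Fintype.linearIndependent_iff.mp (linearIndependent_of_natDegree_injective hP hPinj) _ h i
  have hWdeg : W.natDegree ≤ M :=
    natDegree_sum_le_of_forall_le _ _ fun i _ => (natDegree_smul_le _ _).trans (hPdeg i)
  refine (card_le_degree_of_subset_roots fun x hx => ?_).trans hWdeg
  obtain ⟨α, hα, β, hrel⟩ := hZ x hx
  have hvanish : α * σ (W.eval x) = 0 := by
    calc α * σ (W.eval x) = ∑ i, c i * (α * σ ((P i).eval x)) := by
          simp only [W, eval_finsetSum, map_sum, eval_smul, smul_eq_mul, map_mul, hσ _,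
            Finset.mul_sum]
          exact Finset.sum_congr rfl fun i _ => by ring
      _ = β * (∑ i, c i • T i).eval x := by
          simp only [hrel, eval_finsetSum, eval_smul, smul_eq_mul, Finset.mul_sum]
          exact Finset.sum_congr rfl fun i _ => by ring
      _ = 0 := by rw [hc, eval_zero, mul_zero]
  rw [mem_roots hW, IsRoot.def]
  exact (map_eq_zero σ).mp ((mul_eq_zero.mp hvanish).resolve_left hα)

/-- The polynomial representing `x ^ (e + ρ * N) * g ^ l`, where `g = A / x ^ ρ` and `l ≤ N`. -/
noncomputable def twistedMonomial {E : Type*} [Field E] (ρ N : ℕ) (A : E[X]) (e l : ℕ) : E[X] :=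
  X ^ (e + ρ * (N - l)) * A ^ l

section TwistedMonomial

variable {E : Type*} [Field E] {ρ N e l : ℕ} {A : E[X]}

theorem twistedMonomial_ne_zero (hA : A ≠ 0) : twistedMonomial ρ N A e l ≠ 0 :=
  mul_ne_zero (pow_ne_zero _ X_ne_zero) (pow_ne_zero _ hA)

theorem natDegree_twistedMonomial (hl : l ≤ N) (hA : A ≠ 0) (hdeg : A.natDegree = 2 * ρ) :
    (twistedMonomial ρ N A e l).natDegree = e + ρ * l + ρ * N := by
  obtain ⟨k, rfl⟩ := Nat.exists_eq_add_of_le hl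
  rw [twistedMonomial, natDegree_mul (pow_ne_zero _ X_ne_zero) (pow_ne_zero _ hA),
    natDegree_X_pow, natDegree_pow, hdeg, Nat.add_sub_cancel_left]
  ring

theorem natDegree_twistedMonomial_le (hl : l ≤ N) (hdeg : A.natDegree ≤ 2 * ρ) :
    (twistedMonomial ρ N A e l).natDegree ≤ e + ρ * l + ρ * N := by
  obtain ⟨k, rfl⟩ := Nat.exists_eq_add_of_le hl
  calc (twistedMonomial ρ (l + k) A e l).natDegree
      ≤ (e + ρ * (l + k - l)) + l * (2 * ρ) := natDegree_mul_le_of_le (natDegree_X_pow_le _)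
        (natDegree_pow_le.trans (Nat.mul_le_mul_left _ hdeg))
    _ = e + ρ * l + ρ * (l + k) := by rw [Nat.add_sub_cancel_left]; ring

theorem eval_twistedMonomial (hl : l ≤ N) {x g : E} (hA : A.eval x = x ^ ρ * g) :
    (twistedMonomial ρ N A e l).eval x = x ^ (e + ρ * N) * g ^ l := by
  obtain ⟨k, rfl⟩ := Nat.exists_eq_add_of_le hl
  rw [twistedMonomial, eval_mul, eval_pow, eval_X, eval_pow, hA, Nat.add_sub_cancel_left]
  ring

theorem pow_mul_map_eval_twistedMonomial {σ : E →+* E} (hσσ : Function.Involutive σ) {r : ℕ}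
    (hσ : ∀ x, σ x = x ^ r) {A' : E[X]} {x g : E} (hA : A.eval x = x ^ ρ * g)
    (hA' : A'.eval x = x ^ ρ * σ g) (hl : l ≤ N) (i j : ℕ) :
    x ^ (ρ * N) * σ ((twistedMonomial ρ N A (i + r * j) l).eval x) =
      (x ^ r) ^ (ρ * N) * (twistedMonomial ρ N A' (r * i + j) l).eval x := by
  have hexp : σ (x ^ (i + r * j)) = x ^ (r * i + j) := by
    rw [pow_add, pow_mul, map_mul, map_pow, map_pow, ← hσ x, hσσ, hσ, ← pow_mul, ← pow_add]
  rw [eval_twistedMonomial hl hA, eval_twistedMonomial hl hA', pow_add x (i + r * j), map_mul,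
    map_mul, hexp, map_pow σ x, map_pow σ g, hσ x]
  ring

end TwistedMonomial

/-- The mixed-radix expansion `n = i + ρ * (l + q * j)` of the numbers below `B * (q * ρ)`. -/
def mixedRadix (B q ρ : ℕ) : Fin B × Fin q × Fin ρ ≃ Fin (B * (q * ρ)) :=
  (Equiv.prodCongr (Equiv.refl _) finProdFinEquiv).trans finProdFinEquiv

theorem val_mixedRadix {B q ρ : ℕ} (v : Fin B × Fin q × Fin ρ) :
    (mixedRadix B q ρ v : ℕ) = v.2.2 + ρ * v.2.1 + q * ρ * v.1 := rfl

/-- The exponents `i + r * j` are so spread out that the polynomials in `A` have distinct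
degrees, while `σ` turns them into the small exponents `r * i + j` in front of powers of
`A'`. -/
theorem card_le_of_eval_eq_pow_mul_map {E : Type*} [Field E] {σ : E →+* E}
    (hσσ : Function.Involutive σ) {q ρ r : ℕ} (hq : 1 < q) (hρ : 0 < ρ)
    (hr : r = q * ρ) (hσ : ∀ x, σ x = x ^ r) {A A' : E[X]} (hA : A ≠ 0)
    (hAdeg : A.natDegree = 2 * ρ) (hA'deg : A'.natDegree ≤ 2 * ρ) (Z : Finset E)
    (hZ : ∀ x ∈ Z, x ≠ 0 ∧ ∃ g, A.eval x = x ^ ρ * g ∧ A'.eval x = x ^ ρ * σ g) :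
    Z.card ≤ r * (ρ + 4) := by
  obtain ⟨N, rfl⟩ : ∃ N, q = N + 1 := Nat.exists_eq_add_one.mpr (by omega)
  have hrN : r = ρ * N + ρ := by rw [hr]; ring
  have hρN : ρ ≤ ρ * N := Nat.le_mul_of_pos_right _ (by omega)
  let P (v : Fin (ρ + 3) × Fin (N + 1) × Fin ρ) : E[X] :=
    twistedMonomial ρ N A (v.2.2 + r * v.1) v.2.1
  let T (v : Fin (ρ + 3) × Fin (N + 1) × Fin ρ) : E[X] :=
    twistedMonomial ρ N A' (r * v.2.2 + v.1) v.2.1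
  have hl (v : Fin (ρ + 3) × Fin (N + 1) × Fin ρ) : (v.2.1 : ℕ) ≤ N := Fin.is_le _
  have hPdeg (v) : (P v).natDegree = mixedRadix (ρ + 3) (N + 1) ρ v + ρ * N := by
    rw [natDegree_twistedMonomial (hl v) hA hAdeg, val_mixedRadix, ← hr]
    ring
  have hPinj : Function.Injective fun v => (P v).natDegree := fun v w h => by
    simp only [hPdeg] at h
    exact (mixedRadix _ _ _).injective (Fin.val_injective (Nat.add_right_cancel h))
  have hPle (v) : (P v).natDegree ≤ r * (ρ + 4) := by
    have hv : (mixedRadix (ρ + 3) (N + 1) ρ v : ℕ) < (ρ + 3) * r :=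
      (Fin.is_lt _).trans_eq (by rw [hr])
    rw [hPdeg]
    linarith
  have hTlt (v) : (T v).natDegree < r * ρ + r + 3 - ρ := by
    refine (natDegree_twistedMonomial_le (hl v) hA'deg).trans_lt ?_
    have hi : r * v.2.2 + r ≤ r * ρ := Nat.mul_le_mul_left r v.2.2.2
    have hρl : ρ * v.2.1 ≤ ρ * N := Nat.mul_le_mul_left ρ (hl v)
    have hj := v.1.2
    omega
  have hcard : r * ρ + r + 3 - ρ < Fintype.card (Fin (ρ + 3) × Fin (N + 1) × Fin ρ) := by
    have hexpand : (ρ + 3) * r = r * ρ + 3 * r := by ring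
    simp only [Fintype.card_prod, Fintype.card_fin, ← hr]
    omega
  refine card_le_of_involutive_map_eval hσσ (fun v => twistedMonomial_ne_zero hA) hPinj hPle hTlt
    hcard Z fun x hx => ?_
  obtain ⟨hx0, g, hAx, hA'x⟩ := hZ x hx
  exact ⟨x ^ (ρ * N), pow_ne_zero _ hx0, (x ^ r) ^ (ρ * N), fun v =>
    pow_mul_map_eval_twistedMonomial hσσ hσ hAx hA'x (hl v) _ _⟩

theorem frobeniusAlgHom_pow_apply {F E : Type*} [Field F] [Fintype F] [CommRing E] [Algebra F E]
    (n : ℕ) (x : E) : (FiniteField.frobeniusAlgHom F E ^ n) x = x ^ Fintype.card F ^ n := by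
  rw [AlgHom.coe_pow, FiniteField.coe_frobeniusAlgHom, pow_iterate]

theorem algebraMap_trace_eq_add_pow {F E : Type*} [Field F] [Fintype F] [Field E] [Finite E]
    [Algebra F E] {n : ℕ} (hE : Module.finrank F E = 2 * n) (y : E) :
    algebraMap F E (Algebra.trace F E y) =
      ∑ i ∈ Finset.range n, y ^ Fintype.card F ^ i +
        (∑ i ∈ Finset.range n, y ^ Fintype.card F ^ i) ^ Fintype.card F ^ n := by
  rw [FiniteField.algebraMap_trace_eq_sum_pow, hE, two_mul, Finset.sum_range_add,
    Nat.card_eq_fintype_card, ← frobeniusAlgHom_pow_apply n, map_sum]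
  simp only [frobeniusAlgHom_pow_apply, ← pow_mul, ← pow_add, add_comm n]

/-- The polynomial `X ^ (q ^ m) * ∑_{i ≤ m} (X + t / X) ^ (q ^ i)`, for `q` the cardinality of a
field of constants. When the whole field has degree `2 * (m + 1)` over it, the sum is half of the
trace of `X + t / X`. -/
noncomputable def halfTracePoly {E : Type*} [Field E] (q m : ℕ) (t : E) : E[X] :=
  ∑ i ∈ Finset.range (m + 1),
    (X ^ (q ^ m + q ^ i) + C (t ^ q ^ i) * X ^ (q ^ m - q ^ i))

section HalfTrace

variable {E : Type*} [Field E]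

theorem natDegree_halfTracePoly {q : ℕ} (hq : 1 < q) (m : ℕ) (t : E) :
    (halfTracePoly q m t).natDegree = 2 * q ^ m := by
  have hpos : 0 < q ^ m := pow_pos (by omega) m
  rw [halfTracePoly, Finset.sum_range_succ, Nat.sub_self, pow_zero, mul_one, ← add_assoc,
    natDegree_add_C, natDegree_add_eq_right_of_natDegree_lt, natDegree_X_pow, two_mul]
  rw [natDegree_X_pow]
  refine Nat.lt_of_le_pred (by omega) (natDegree_sum_le_of_forall_le _ _ fun i hi => ?_)
  have hlt : q ^ i < q ^ m := Nat.pow_lt_pow_right hq (Finset.mem_range.mp hi)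
  refine natDegree_add_le_of_degree_le ?_ ((natDegree_C_mul_X_pow_le _ _).trans ?_)
  · rw [natDegree_X_pow, Nat.pred_eq_sub_one]
    omega
  · rw [Nat.pred_eq_sub_one]
    omega

theorem halfTracePoly_ne_zero {q : ℕ} (hq : 1 < q) (m : ℕ) (t : E) :
    halfTracePoly q m t ≠ 0 :=
  ne_zero_of_natDegree_gt (n := 0) <| by
    rw [natDegree_halfTracePoly hq]
    exact Nat.mul_pos two_pos (pow_pos (by omega) m)

theorem eval_halfTracePoly {F : Type*} [Field F] [Fintype F] [Algebra F E] (m : ℕ) (t : E) {x : E}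
    (hx : x ≠ 0) :
    (halfTracePoly (Fintype.card F) m t).eval x = x ^ (Fintype.card F ^ m) *
      ∑ i ∈ Finset.range (m + 1), (x + t / x) ^ (Fintype.card F ^ i) := by
  rw [halfTracePoly, eval_finsetSum, Finset.mul_sum]
  refine Finset.sum_congr rfl fun i hi => ?_
  have hle : Fintype.card F ^ i ≤ Fintype.card F ^ m :=
    Nat.pow_le_pow_right Fintype.card_pos (Nat.lt_succ_iff.mp (Finset.mem_range.mp hi))
  simp only [eval_add, eval_pow, eval_X, eval_mul, eval_C]
  rw [← frobeniusAlgHom_pow_apply i (x + t / x), map_add, frobeniusAlgHom_pow_apply,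
    frobeniusAlgHom_pow_apply, div_pow, mul_add, ← pow_add, pow_sub₀ x hx hle]
  field_simp

end HalfTrace

open Classical in
/-- The involution `x ↦ x ^ q ^ (m + 1)` maps the half trace `g` of `x + t / x` to `s - g`. -/
theorem card_trace_add_div_eq_le {F E : Type*} [Field F] [Fintype F] [Field E] [Fintype E]
    [Algebra F E] {m : ℕ} (hE : Module.finrank F E = 2 * (m + 1)) (t : E) (s : F) :
    (Finset.univ.filter fun x : E => x ≠ 0 ∧ Algebra.trace F E (x + t / x) = s).card ≤
      Fintype.card F ^ (m + 1) * (Fintype.card F ^ m + 4) := by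
  set q := Fintype.card F
  have hq : 1 < q := Fintype.one_lt_card
  let σ := FiniteField.frobeniusAlgHom F E ^ (m + 1)
  have hσ (x : E) : σ x = x ^ q ^ (m + 1) := frobeniusAlgHom_pow_apply _ x
  have hσσ : Function.Involutive σ := fun x => by
    rw [hσ, hσ, ← pow_mul, ← pow_two, ← pow_mul, mul_comm, ← hE, ← Module.card_eq_pow_finrank,
      FiniteField.pow_card]
  let G := halfTracePoly q m t
  let G' := C (algebraMap F E s) * X ^ q ^ m - G
  have hGdeg : G.natDegree = 2 * q ^ m := natDegree_halfTracePoly hq m t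
  have hG'deg : G'.natDegree ≤ 2 * q ^ m := (natDegree_sub_le _ _).trans <|
    max_le ((natDegree_C_mul_X_pow_le _ _).trans (Nat.le_mul_of_pos_left _ two_pos)) hGdeg.le
  refine card_le_of_eval_eq_pow_mul_map (σ := (σ : E →+* E)) hσσ hq (pow_pos (by omega) m)
    (pow_succ' q m) hσ (halfTracePoly_ne_zero hq m t) hGdeg hG'deg _ fun x hx => ?_
  obtain ⟨-, hx0, hs⟩ := Finset.mem_filter.mp hx
  set g := ∑ i ∈ Finset.range (m + 1), (x + t / x) ^ q ^ i
  have hGx : G.eval x = x ^ q ^ m * g := eval_halfTracePoly m t hx0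
  have hσg : σ g = algebraMap F E s - g := by
    rw [← hs, algebraMap_trace_eq_add_pow hE, add_sub_cancel_left, hσ]
  refine ⟨hx0, g, hGx, ?_⟩
  simp only [G', eval_sub, eval_mul, eval_C, eval_pow, eval_X, hGx, RingHom.coe_coe, hσg]
  ring

end Stepanov

section WeilBound

theorem norm_sum_mul_addChar_le {F : Type*} [Field F] [Fintype F] {ψ : AddChar F ℂ} (hψ : ψ ≠ 1)
    {N : F → ℝ} {B : ℝ} (hN : ∀ s, N s ≤ B) :
    ‖∑ s, (N s : ℂ) * ψ s‖ ≤ Fintype.card F * B - ∑ s, N s := by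
  have hcompl : ∑ s, (N s : ℂ) * ψ s = -∑ s, ((B - N s : ℝ) : ℂ) * ψ s := by
    have hsum : ∑ s, ψ s = 0 := AddChar.sum_eq_zero_of_ne_one hψ
    simp only [Complex.ofReal_sub, sub_mul, Finset.sum_sub_distrib, ← Finset.mul_sum, hsum]
    ring
  calc ‖∑ s, (N s : ℂ) * ψ s‖ ≤ ∑ s, ‖((B - N s : ℝ) : ℂ) * ψ s‖ := by
        rw [hcompl, norm_neg]
        exact norm_sum_le _ _
    _ = ∑ s, (B - N s) := Finset.sum_congr rfl fun s _ => by
        rw [norm_mul, AddChar.norm_apply, mul_one, Complex.norm_real,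
          Real.norm_of_nonneg (sub_nonneg.mpr (hN s))]
    _ = Fintype.card F * B - ∑ s, N s := by
        rw [Finset.sum_sub_distrib, Finset.sum_const, Finset.card_univ, nsmul_eq_mul]

section

variable {F E : Type*} [Field F] [Fintype F] [Field E] [Fintype E] [Algebra F E]

open Classical in
theorem kloosterman_traceLift_eq_sum_card (ψ : AddChar F ℂ) (t : E) :
    kloosterman (traceLift E ψ) t = ∑ s : F, ((Finset.univ.filter fun x : E =>
      x ≠ 0 ∧ Algebra.trace F E (x + t / x) = s).card : ℂ) * ψ s := by
  simp only [kloosterman, traceLift_apply]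
  rw [← Finset.sum_fiberwise' _ (fun x => Algebra.trace F E (x + t / x)) fun s => ψ s]
  simp only [Finset.sum_const, nsmul_eq_mul, Finset.filter_filter]

open Classical in
theorem sum_card_trace_add_div_eq (t : E) :
    ∑ s : F, (Finset.univ.filter fun x : E =>
      x ≠ 0 ∧ Algebra.trace F E (x + t / x) = s).card = Fintype.card E - 1 := by
  have hfibers := Finset.card_eq_sum_card_fiberwise (s := Finset.univ.filter fun x : E => x ≠ 0)
    (t := Finset.univ) (f := fun x => Algebra.trace F E (x + t / x)) (by simp)
  simp only [Finset.filter_filter] at hfibers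
  rw [← hfibers, Finset.filter_ne', Finset.card_erase_of_mem (Finset.mem_univ _),
    Finset.card_univ]

theorem norm_kloosterman_traceLift_le_of_even {ψ : AddChar F ℂ} (hψ : ψ ≠ 1)
    (hE : Even (Module.finrank F E)) (t : E) :
    ‖kloosterman (traceLift E ψ) t‖ ≤ (2 + 4 * Fintype.card F) * √(Fintype.card E : ℝ) := by
  classical
  obtain ⟨m, hm⟩ : ∃ m, Module.finrank F E = 2 * (m + 1) := by
    obtain ⟨n, hn⟩ := even_iff_exists_two_mul.mp hE
    have : 0 < Module.finrank F E := Module.finrank_pos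
    exact ⟨n - 1, by omega⟩
  have hcard : (Fintype.card E : ℝ) = ((Fintype.card F : ℝ) ^ (m + 1)) ^ 2 := by
    rw [← pow_mul, mul_comm (m + 1), ← hm]
    exact_mod_cast Module.card_eq_pow_finrank (K := F) (V := E)
  have hbound := norm_sum_mul_addChar_le hψ fun s : F =>
    (Nat.cast_le (α := ℝ)).mpr (card_trace_add_div_eq_le hm t s)
  simp only [Complex.ofReal_natCast] at hbound
  rw [← kloosterman_traceLift_eq_sum_card, ← Nat.cast_sum, sum_card_trace_add_div_eq,
    Nat.cast_pred Fintype.card_pos, hcard] at hbound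
  have hone : (1 : ℝ) ≤ (Fintype.card F : ℝ) ^ (m + 1) :=
    one_le_pow₀ (by exact_mod_cast Fintype.card_pos)
  rw [hcard, Real.sqrt_sq (by positivity)]
  refine hbound.trans ?_
  push_cast
  rw [pow_succ] at hone ⊢
  linarith

end

theorem exists_finite_quadratic_extension (E : Type*) [Field E] [Finite E] :
    ∃ (L : Type) (_ : Field L) (_ : Fintype L) (_ : Algebra E L), Module.finrank E L = 2 := by
  obtain ⟨p, _⟩ := CharP.exists E
  have : Fact p.Prime := ⟨CharP.char_is_prime E p⟩
  exact ⟨FiniteField.Extension E p 2, inferInstance, Fintype.ofFinite _, inferInstance,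
    FiniteField.finrank_extension E p 2⟩

variable {E : Type*} [Field E] [Fintype E]

theorem norm_kloosterman_le_of_quadratic {L : Type*} [Field L] [Fintype L] [Algebra E L]
    (h : Module.finrank E L = 2) {ψ : AddChar E ℂ} (hψ : ψ ≠ 1) {a : E} (ha : a ≠ 0) {δ : ℝ}
    (hδ : 0 ≤ δ) (hL : ‖kloosterman (traceLift L ψ) (algebraMap E L a)‖ ≤
      (2 + δ) * √(Fintype.card L : ℝ)) :
    ‖kloosterman ψ a‖ ≤ (2 + δ / 4) * √(Fintype.card E : ℝ) := by
  have hcard : (Fintype.card L : ℝ) = (Fintype.card E : ℝ) ^ 2 := by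
    rw [← h]
    exact_mod_cast Module.card_eq_pow_finrank (K := E) (V := L)
  rw [hcard, Real.sqrt_sq (Nat.cast_nonneg _)] at hL
  refine le_of_sq_le_sq ?_ (by positivity)
  calc ‖kloosterman ψ a‖ ^ 2
      = ‖2 * (Fintype.card E : ℂ) - kloosterman (traceLift L ψ) (algebraMap E L a)‖ := by
        rw [← norm_pow, ← kloosterman_sq_add_kloosterman_traceLift h hψ ha, add_sub_cancel_right]
    _ ≤ 2 * Fintype.card E + (2 + δ) * Fintype.card E := by
        refine (norm_sub_le _ _).trans (add_le_add (le_of_eq ?_) hL)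
        rw [norm_mul, Complex.norm_natCast, Complex.norm_ofNat]
    _ ≤ ((2 + δ / 4) * √(Fintype.card E : ℝ)) ^ 2 := by
        rw [mul_pow, Real.sq_sqrt (Nat.cast_nonneg _)]
        have := mul_nonneg (sq_nonneg δ) (Nat.cast_nonneg (α := ℝ) (Fintype.card E))
        linarith

theorem norm_kloosterman_traceLift_le_add_div_pow {ψ : AddChar E ℂ} (hψ : ψ ≠ 1) (j : ℕ) :
    ∀ (K : Type) [Field K] [Fintype K] [Algebra E K], Even (Module.finrank E K) →
      ∀ a : K, a ≠ 0 → ‖kloosterman (traceLift K ψ) a‖ ≤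
        (2 + 4 * Fintype.card E / 4 ^ j) * √(Fintype.card K : ℝ) := by
  induction j with
  | zero =>
    intro K _ _ _ hK a _
    simpa using norm_kloosterman_traceLift_le_of_even hψ hK a
  | succ j ih =>
    intro K _ _ _ hK a ha
    obtain ⟨L, _, _, _, h⟩ := exists_finite_quadratic_extension K
    let _ : Algebra E L := Algebra.compHom L (algebraMap E K)
    have : IsScalarTower E K L := IsScalarTower.of_algebraMap_eq fun _ => rfl
    have hL : Even (Module.finrank E L) := by
      rw [← Module.finrank_mul_finrank E K L]
      exact hK.mul_right _
    rw [pow_succ, ← div_div]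
    refine norm_kloosterman_le_of_quadratic h (traceLift_ne_one hψ) ha (by positivity) ?_
    rw [traceLift_traceLift]
    exact ih L hL _ ((map_ne_zero _).mpr ha)

theorem norm_kloosterman_le {ψ : AddChar E ℂ} (hψ : ψ ≠ 1) {a : E} (ha : a ≠ 0) :
    ‖kloosterman ψ a‖ ≤ 2 * √(Fintype.card E : ℝ) := by
  obtain ⟨L, _, _, _, h⟩ := exists_finite_quadratic_extension E
  have herror : Filter.Tendsto (fun j : ℕ => 4 * (Fintype.card E : ℝ) / 4 ^ j) Filter.atTop
      (nhds 0) :=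
    tendsto_const_nhds.div_atTop (tendsto_pow_atTop_atTop_of_one_lt (by norm_num))
  have hL : ‖kloosterman (traceLift L ψ) (algebraMap E L a)‖ ≤ (2 + 0) * √(Fintype.card L : ℝ) :=
    ge_of_tendsto' ((herror.const_add 2).mul_const _) fun j =>
      norm_kloosterman_traceLift_le_add_div_pow hψ j L (h ▸ even_two) _ ((map_ne_zero _).mpr ha)
  simpa using norm_kloosterman_le_of_quadratic h hψ ha le_rfl hL

end WeilBound

section GaussSums

open QuadraticMap

theorem sum_addChar_linearMap_eq_ite {F M : Type*} [Field F] [AddCommGroup M] [Module F M]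
    [Fintype M] {ψ : AddChar F ℂ} (hψ : ψ ≠ 1) (f : M →ₗ[F] F) [Decidable (f = 0)] :
    ∑ x : M, ψ (f x) = if f = 0 then (Fintype.card M : ℂ) else 0 := by
  split_ifs with hf
  · simp [hf]
  · obtain ⟨c, hc⟩ := AddChar.ne_one_iff.mp hψ
    obtain ⟨x, rfl⟩ := f.surjective_of_ne_zero hf c
    exact AddChar.sum_eq_zero_of_ne_one (ψ := ψ.compAddMonoidHom f.toAddMonoidHom)
      (AddChar.ne_one_iff.mpr ⟨x, hc⟩)

theorem sum_sum_addChar_mul_eq {F V : Type*} [Field F] [Fintype F] [DecidableEq F]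
    {ψ : AddChar F ℂ} (hψ : ψ ≠ 1) (W : Finset V) (f : V → F) :
    ∑ c, ∑ w ∈ W, ψ (c * f w) = Fintype.card F * (W.filter fun w => f w = 0).card := by
  rw [Finset.sum_comm]
  simp [sum_addChar_mul_eq_ite hψ, Finset.sum_ite, mul_comm]

theorem sum_addChar_mul_add_polar {F V : Type*} [Field F] [AddCommGroup V] [Module F V]
    [Fintype V] (Q : QuadraticForm F V) (ψ : AddChar F ℂ) {c : F} (hc : c ≠ 0) (u : V) :
    ∑ w, ψ (c * Q w + polar Q u w) = ψ (-(Q u / c)) * ∑ w, ψ (c * Q w) := by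
  rw [← Equiv.sum_comp (Equiv.addRight (c⁻¹ • u)) fun w => ψ (c * Q w), Finset.mul_sum]
  refine Finset.sum_congr rfl fun w _ => ?_
  rw [← AddChar.map_add_eq_mul, Equiv.coe_addRight, QuadraticMap.map_add Q, polar_smul_right,
    QuadraticMap.map_smul, polar_comm Q w u, smul_eq_mul, smul_eq_mul]
  congr 1
  field_simp
  ring

open Classical in
theorem sum_addChar_mul_conj {F V : Type*} [Field F] [Finite F] [AddCommGroup V] [Module F V]
    [Fintype V] {Q : QuadraticForm F V} {ψ : AddChar F ℂ} (hψ : ψ ≠ 1)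
    (hrad : ∀ u, Q.polarBilin u = 0 → Q u = 0) :
    (∑ w, ψ (Q w)) * starRingEnd ℂ (∑ w, ψ (Q w)) =
      Fintype.card V * (Finset.univ.filter fun u => Q.polarBilin u = 0).card := by
  have hshift (w' : V) : ∑ w, ψ (Q w) * starRingEnd ℂ (ψ (Q w')) =
      ∑ u, ψ (Q u) * ψ (Q.polarBilin u w') := by
    rw [← Equiv.sum_comp (Equiv.addRight w')]
    refine Finset.sum_congr rfl fun u _ => ?_
    rw [← AddChar.map_neg_eq_conj, ← AddChar.map_add_eq_mul, ← AddChar.map_add_eq_mul,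
      Equiv.coe_addRight, QuadraticMap.map_add Q, polarBilin_apply_apply]
    congr 1
    ring
  rw [map_sum, Finset.sum_mul_sum, Finset.sum_comm, Finset.sum_congr rfl fun w' _ => hshift w',
    Finset.sum_comm, Finset.card_filter, Nat.cast_sum, Finset.mul_sum]
  refine Finset.sum_congr rfl fun u _ => ?_
  rw [← Finset.mul_sum, sum_addChar_linearMap_eq_ite hψ]
  split_ifs with hu
  · simp [hrad u hu]
  · simp

/-- The subspace of the vectors orthogonal to `U` for the polar form of `Q`. -/
def polarPerp {F V : Type*} [Field F] [AddCommGroup V] [Module F V] (Q : QuadraticForm F V)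
    (U : Submodule F V) : Submodule F V :=
  LinearMap.BilinForm.orthogonal Q.polarBilin U

theorem mem_polarPerp {F V : Type*} [Field F] [AddCommGroup V] [Module F V]
    {Q : QuadraticForm F V} {U : Submodule F V} {w : V} :
    w ∈ polarPerp Q U ↔ ∀ u ∈ U, polar Q u w = 0 :=
  Iff.rfl

open Classical in
theorem sum_mul_sum_addChar_polar {F V : Type*} [Field F] [AddCommGroup V] [Module F V]
    [Fintype V] {Q : QuadraticForm F V} {ψ : AddChar F ℂ} (hψ : ψ ≠ 1) (U : Submodule F V)
    (f : V → ℂ) :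
    ∑ w, f w * ∑ u : U, ψ (polar Q u w) = Fintype.card U * ∑ w with w ∈ polarPerp Q U, f w := by
  have hinner (w : V) : ∑ u : U, ψ (polar Q u w) =
      if w ∈ polarPerp Q U then (Fintype.card U : ℂ) else 0 := by
    have hmem : (Q.polarBilin.flip w).comp U.subtype = 0 ↔ w ∈ polarPerp Q U := by
      simp [LinearMap.ext_iff, mem_polarPerp]
    rw [← if_congr hmem rfl rfl, ← sum_addChar_linearMap_eq_ite hψ]
    rfl
  simp only [hinner, mul_ite, mul_zero, ← Finset.sum_filter, ← Finset.sum_mul, mul_comm]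

/-- The form `Q` has the exponential sums of a nondegenerate form of minus type in dimension
`2 * N`. -/
def HasMinusGaussSums {F V : Type*} [Field F] [Fintype F] [AddCommGroup V] [Module F V]
    [Fintype V] (Q : QuadraticForm F V) (ψ : AddChar F ℂ) (N : ℕ) : Prop :=
  Fintype.card V = Fintype.card F ^ (2 * N) ∧
    ∀ c : F, c ≠ 0 → ∑ w, ψ (c * Q w) = -(Fintype.card F : ℂ) ^ N

namespace HasMinusGaussSums

variable {F V : Type*} [Field F] [Fintype F] [AddCommGroup V] [Module F V] [Fintype V]
  {Q : QuadraticForm F V} {ψ : AddChar F ℂ} {N : ℕ}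

theorem map_eq_zero_of_polarBilin_eq_zero (hQ : HasMinusGaussSums Q ψ N) (hψ : ψ ≠ 1) {u : V}
    (hu : Q.polarBilin u = 0) : Q u = 0 := by
  by_contra hQu
  obtain ⟨d, hd⟩ := AddChar.ne_one_iff.mp hψ
  have hd0 : d ≠ 0 := by
    rintro rfl
    exact hd (AddChar.map_zero_eq_one ψ)
  have hc : -(Q u / d) ≠ 0 := neg_ne_zero.mpr (div_ne_zero hQu hd0)
  have hpolar (w : V) : polar Q u w = 0 := DFunLike.congr_fun hu w
  have hinvariant := sum_addChar_mul_add_polar Q ψ hc u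
  simp only [hpolar, add_zero] at hinvariant
  have hne : ∑ w, ψ (-(Q u / d) * Q w) ≠ 0 := by
    rw [hQ.2 _ hc]
    exact neg_ne_zero.mpr (pow_ne_zero _ (Nat.cast_ne_zero.mpr Fintype.card_ne_zero))
  have hval : -(Q u / -(Q u / d)) = d := by
    field_simp
  rw [hval] at hinvariant
  exact hd (mul_eq_right₀ hne |>.mp hinvariant.symm)

theorem polarBilin_ne_zero (hQ : HasMinusGaussSums Q ψ N) (hψ : ψ ≠ 1) {u : V} (hu : u ≠ 0) :
    Q.polarBilin u ≠ 0 := by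
  classical
  have hconj := sum_addChar_mul_conj hψ fun v => hQ.map_eq_zero_of_polarBilin_eq_zero hψ (u := v)
  have hsum := hQ.2 1 one_ne_zero
  simp only [one_mul] at hsum
  have hsquare : (∑ w, ψ (Q w)) * starRingEnd ℂ (∑ w, ψ (Q w)) = Fintype.card V * 1 := by
    rw [hsum, hQ.1]
    simp only [map_neg, map_pow, map_natCast, Nat.cast_pow]
    ring
  have hcard : (Finset.univ.filter fun v : V => Q.polarBilin v = 0).card ≤ 1 :=
    le_of_eq <| by
      exact_mod_cast mul_left_cancel₀ (Nat.cast_ne_zero.mpr Fintype.card_ne_zero)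
        (hconj.symm.trans hsquare)
  exact fun h => hu (Finset.card_le_one.mp hcard u (by simpa using h) 0 (by simp))

theorem nondegenerate (hQ : HasMinusGaussSums Q ψ N) (hψ : ψ ≠ 1) : Q.polarBilin.Nondegenerate := by
  have hrefl : Q.polarBilin.IsRefl := fun u w h => by
    rwa [polarBilin_apply_apply, polar_comm, ← polarBilin_apply_apply]
  refine hrefl.nondegenerate_iff_separatingLeft.mpr fun u hu => ?_
  by_contra hne
  exact hQ.polarBilin_ne_zero hψ hne (LinearMap.ext hu)

theorem finrank_polarPerp_add (hQ : HasMinusGaussSums Q ψ N) (hψ : ψ ≠ 1) (U : Submodule F V) :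
    Module.finrank F (polarPerp Q U) + Module.finrank F U = 2 * N := by
  have hV : Module.finrank F V = 2 * N := by
    refine Nat.pow_right_injective (Fintype.one_lt_card (α := F)) ?_
    simpa using Module.card_eq_pow_finrank.symm.trans hQ.1
  have hperp := LinearMap.BilinForm.finrank_orthogonal (hQ.nondegenerate hψ) U
  have hle := U.finrank_le
  rw [polarPerp, hperp]
  omega

open Classical in
theorem sum_polarPerp_addChar_mul (hQ : HasMinusGaussSums Q ψ N) (hψ : ψ ≠ 1)
    {U : Submodule F V} (hU : TotallySingular Q U) {c : F} (hc : c ≠ 0) :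
    ∑ w with w ∈ polarPerp Q U, ψ (c * Q w) = -(Fintype.card F : ℂ) ^ N := by
  have hcardU : (Fintype.card U : ℂ) ≠ 0 := Nat.cast_ne_zero.mpr Fintype.card_ne_zero
  refine mul_left_cancel₀ hcardU ?_
  rw [← sum_mul_sum_addChar_polar hψ]
  simp only [Finset.mul_sum, ← AddChar.map_add_eq_mul]
  rw [Finset.sum_comm]
  simp only [sum_addChar_mul_add_polar Q ψ hc, hU _ (Subtype.prop _), hQ.2 c hc]
  simp

open Classical in
theorem card_mul_card_polarPerp_singular (hQ : HasMinusGaussSums Q ψ N) (hψ : ψ ≠ 1)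
    {U : Submodule F V} (hU : TotallySingular Q U) :
    (Fintype.card F : ℂ) * (Finset.univ.filter fun w => w ∈ polarPerp Q U ∧ Q w = 0).card =
      Fintype.card (polarPerp Q U) - (Fintype.card F - 1) * (Fintype.card F : ℂ) ^ N := by
  have hnonzero : ∑ c ∈ Finset.univ.erase (0 : F), ∑ w with w ∈ polarPerp Q U, ψ (c * Q w) =
      -((Fintype.card F - 1) * (Fintype.card F : ℂ) ^ N) := by
    rw [Finset.sum_congr rfl fun c hc =>
      hQ.sum_polarPerp_addChar_mul hψ hU (Finset.ne_of_mem_erase hc), Finset.sum_const,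
      Finset.card_erase_of_mem (Finset.mem_univ _), Finset.card_univ,
      nsmul_eq_mul, Nat.cast_pred Fintype.card_pos, mul_neg]
  rw [← Finset.filter_filter, ← sum_sum_addChar_mul_eq hψ,
    ← Finset.add_sum_erase _ _ (Finset.mem_univ 0), hnonzero]
  simp [Fintype.card_subtype, sub_eq_add_neg]

end HasMinusGaussSums

end GaussSums

section PolarSpace

open QuadraticMap

namespace TotallySingular

variable {F V : Type*} [Field F] [AddCommGroup V] [Module F V] {Q : QuadraticForm F V}
  {U : Submodule F V}

theorem polar_eq_zero (hU : TotallySingular Q U) {u w : V} (hu : u ∈ U) (hw : w ∈ U) :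
    polar Q u w = 0 := by
  rw [polar, hU _ (U.add_mem hu hw), hU u hu, hU w hw, sub_zero, sub_zero]

theorem le_polarPerp (hU : TotallySingular Q U) : U ≤ polarPerp Q U :=
  fun _ hw _ hu => hU.polar_eq_zero hu hw

theorem sup_span_singleton (hU : TotallySingular Q U) {y : V} (hy : Q y = 0)
    (hyU : y ∈ polarPerp Q U) : TotallySingular Q (U ⊔ Submodule.span F {y}) := by
  intro w hw
  obtain ⟨u, hu, z, hz, rfl⟩ := Submodule.mem_sup.mp hw
  obtain ⟨c, rfl⟩ := Submodule.mem_span_singleton.mp hz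
  rw [QuadraticMap.map_add Q, QuadraticMap.map_smul, polar_smul_right, hU u hu, hy,
    mem_polarPerp.mp hyU u hu, smul_zero, smul_zero, add_zero, add_zero]

end TotallySingular

theorem mem_polarPerp_sup_span_singleton {F V : Type*} [Field F] [AddCommGroup V] [Module F V]
    {Q : QuadraticForm F V} {U : Submodule F V} {x y : V} :
    y ∈ polarPerp Q (U ⊔ Submodule.span F {x}) ↔ y ∈ polarPerp Q U ∧ polar Q x y = 0 := by
  refine ⟨fun h => ⟨fun u hu => h u (Submodule.mem_sup_left hu),
    h x (Submodule.mem_sup_right (Submodule.mem_span_singleton_self x))⟩, ?_⟩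
  rintro ⟨hU, hx⟩ w hw
  obtain ⟨u, hu, z, hz, rfl⟩ := Submodule.mem_sup.mp hw
  obtain ⟨c, rfl⟩ := Submodule.mem_span_singleton.mp hz
  rw [← mem_polarPerp.mp hU u hu, polarBilin_apply_apply, polar_add_left, polar_smul_left, hx,
    smul_zero, add_zero]

theorem mem_sup_span_singleton_comm {F V : Type*} [Field F] [AddCommGroup V] [Module F V]
    {U : Submodule F V} {x y : V} (hx : x ∉ U) (hy : y ∉ U) :
    x ∈ U ⊔ Submodule.span F {y} ↔ y ∈ U ⊔ Submodule.span F {x} := by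
  have hexchange {x y : V} (hx : x ∉ U) (h : x ∈ U ⊔ Submodule.span F {y}) :
      y ∈ U ⊔ Submodule.span F {x} := by
    have := mem_span_insert_exchange (K := F) (s := (U : Set V)) (x := x) (y := y)
    simp only [Submodule.span_insert, Submodule.span_eq, sup_comm (a := Submodule.span F _)] at this
    exact this h hx
  exact ⟨hexchange hx, hexchange hy⟩

theorem sum_sum_filter_eq_of_symmetric {α R : Type*} [NonAssocSemiring R] {D : Finset α}
    {r : α → α → Prop} [DecidableRel r] (hr : ∀ x ∈ D, ∀ y ∈ D, r x y ↔ r y x) {c : ℕ}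
    (hc : ∀ x ∈ D, (D.filter (r x)).card = c) (f : α → R) :
    ∑ y ∈ D, ∑ x ∈ D with r y x, f x = c * ∑ x ∈ D, f x := by
  have hswap := Finset.sum_comm' (s := D) (t := fun y => D.filter (r y)) (t' := D)
    (s' := fun x => D.filter (r x)) (f := fun _ x => f x) fun y x => by
      simp only [Finset.mem_filter]
      constructor
      · rintro ⟨hy, hx, h⟩
        exact ⟨⟨hy, (hr y hy x hx).mp h⟩, hx⟩
      · rintro ⟨⟨hy, h⟩, hx⟩
        exact ⟨hy, hx, (hr x hx y hy).mp h⟩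
  rw [hswap, Finset.mul_sum]
  exact Finset.sum_congr rfl fun x hx => by rw [Finset.sum_const, hc x hx, nsmul_eq_mul]

variable {F V : Type*} [Field F] [AddCommGroup V] [Module F V] [Fintype V]

open Classical in
/-- The singular vectors orthogonal to `U` and not in `U`. For totally singular `U` they represent
the points of the polar space induced on `U^⊥ / U`. -/
noncomputable def residue (Q : QuadraticForm F V) (U : Submodule F V) : Finset V :=
  Finset.univ.filter fun x => (x ∈ polarPerp Q U ∧ Q x = 0) ∧ x ∉ U

variable {Q : QuadraticForm F V} {U : Submodule F V}

theorem mem_residue {x : V} : x ∈ residue Q U ↔ (x ∈ polarPerp Q U ∧ Q x = 0) ∧ x ∉ U := by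
  simp [residue]

theorem TotallySingular.sup_span_residue (hU : TotallySingular Q U) {x : V}
    (hx : x ∈ residue Q U) : TotallySingular Q (U ⊔ Submodule.span F {x}) :=
  hU.sup_span_singleton (mem_residue.mp hx).1.2 (mem_residue.mp hx).1.1

theorem finrank_sup_span_residue {x : V} (hx : x ∈ residue Q U) :
    Module.finrank F (U ⊔ Submodule.span F {x} : Submodule F V) = Module.finrank F U + 1 :=
  Submodule.finrank_sup_span_singleton (mem_residue.mp hx).2

theorem isGenerator_of_residue_eq_empty (hU : TotallySingular Q U) (h : residue Q U = ∅) :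
    IsGenerator Q U := by
  refine ⟨hU, fun W hW hUW w hw => ?_⟩
  by_contra hwU
  have hmem : w ∈ residue Q U :=
    mem_residue.mpr ⟨⟨fun u hu => hW.polar_eq_zero (hUW hu) hw, hW w hw⟩, hwU⟩
  simp [h] at hmem

open Classical in
theorem residue_sup_span_singleton (x : V) :
    residue Q (U ⊔ Submodule.span F {x}) =
      (residue Q U).filter fun y => polar Q x y = 0 ∧ y ∉ U ⊔ Submodule.span F {x} := by
  ext y
  have hsup : y ∉ U ⊔ Submodule.span F {x} → y ∉ U := mt fun h => Submodule.mem_sup_left h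
  simp only [Finset.mem_filter, mem_residue, mem_polarPerp_sup_span_singleton]
  tauto

open Classical in
theorem filter_residue_mem_sup_span_singleton (hU : TotallySingular Q U) {x : V}
    (hx : x ∈ residue Q U) :
    (residue Q U).filter (· ∈ U ⊔ Submodule.span F {x}) =
      (Finset.univ.filter (· ∈ U ⊔ Submodule.span F {x})) \ Finset.univ.filter (· ∈ U) := by
  ext y
  simp only [Finset.mem_filter, mem_residue, Finset.mem_sdiff, Finset.mem_univ, true_and]
  refine ⟨fun h => ⟨h.2, h.1.2⟩, fun h => ⟨⟨⟨?_, hU.sup_span_residue hx y h.1⟩, h.2⟩, h.1⟩⟩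
  exact (mem_polarPerp_sup_span_singleton.mp ((hU.sup_span_residue hx).le_polarPerp h.1)).1

open Classical in
theorem sum_sup_span_residue {K : Type*} [AddCommMonoid K] (hU : TotallySingular Q U) {x : V}
    (hx : x ∈ residue Q U) (f : V → K) :
    ∑ y with y ∈ U ⊔ Submodule.span F {x}, f y =
      (∑ y ∈ residue Q U with y ∈ U ⊔ Submodule.span F {x}, f y) + ∑ y with y ∈ U, f y := by
  rw [filter_residue_mem_sup_span_singleton hU hx, Finset.sum_sdiff]
  exact Finset.monotone_filter_right _ fun y _ h => Submodule.mem_sup_left h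

open Classical in
theorem card_filter_mem_submodule [Fintype F] (U : Submodule F V) :
    (Finset.univ.filter (· ∈ U)).card = Fintype.card F ^ Module.finrank F U := by
  rw [← Module.card_eq_pow_finrank (K := F) (V := U), Fintype.card_subtype]

open Classical in
theorem card_filter_residue_mem_sup_span_singleton [Fintype F] (hU : TotallySingular Q U) {x : V}
    (hx : x ∈ residue Q U) :
    ((residue Q U).filter (· ∈ U ⊔ Submodule.span F {x})).card =
      Fintype.card F ^ Module.finrank F U * (Fintype.card F - 1) := by
  rw [filter_residue_mem_sup_span_singleton hU hx, Finset.card_sdiff_of_subset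
    (Finset.monotone_filter_right _ fun y _ h => Submodule.mem_sup_left h),
    card_filter_mem_submodule, card_filter_mem_submodule, finrank_sup_span_residue hx, pow_succ,
    Nat.mul_sub_one]

open Classical in
theorem sum_residue_mem_sup [Fintype F] {K : Type*} [NonAssocSemiring K]
    (hU : TotallySingular Q U) (f : V → K) :
    ∑ y ∈ residue Q U, ∑ x ∈ residue Q U with x ∈ U ⊔ Submodule.span F {y}, f x =
      (Fintype.card F ^ Module.finrank F U * (Fintype.card F - 1) : ℕ) *
        ∑ x ∈ residue Q U, f x :=
  sum_sum_filter_eq_of_symmetric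
    (fun _ hx _ hy => mem_sup_span_singleton_comm (mem_residue.mp hy).2 (mem_residue.mp hx).2)
    (fun _ hx => card_filter_residue_mem_sup_span_singleton hU hx) f

/-- The induced polar space `U^⊥ / U` has `(q ^ a - 1) * (q ^ a * t + 1) / (q - 1)` points for each
totally singular `U` with `a = n - dim U`. This holds for the polar spaces of rank `n` in which each
totally singular subspace of dimension `n - 1` lies on `q * t + 1` generators; the elliptic quadrics
have `t = q`. -/
def HasResidueCounts [Fintype F] (Q : QuadraticForm F V) (n t : ℕ) : Prop :=
  ∀ (U : Submodule F V) (a : ℕ), TotallySingular Q U → Module.finrank F U + a = n →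
    (residue Q U).card = Fintype.card F ^ Module.finrank F U *
      ((Fintype.card F ^ a - 1) * (Fintype.card F ^ a * t + 1))

namespace HasResidueCounts

variable [Fintype F] {K : Type*} [Field K] {n t : ℕ} {f : V → K} {μ : K}

theorem residue_eq_empty (hQ : HasResidueCounts Q n t) (hU : TotallySingular Q U)
    (hn : Module.finrank F U = n) : residue Q U = ∅ := by
  rw [← Finset.card_eq_zero, hQ U 0 hU hn]
  simp

theorem sum_residue_residue (hQ : HasResidueCounts Q n t) (hU : TotallySingular Q U) {a : ℕ}
    (hn : Module.finrank F U + (a + 1) = n) (f : V → K) :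
    ∑ y ∈ residue Q U, ∑ x ∈ residue Q (U ⊔ Submodule.span F {y}), f x =
      (Fintype.card F ^ (Module.finrank F U + 1) *
        ((Fintype.card F ^ a - 1) * (Fintype.card F ^ a * t + 1)) : ℕ) *
          ∑ x ∈ residue Q U, f x := by
  classical
  simp only [residue_sup_span_singleton]
  refine sum_sum_filter_eq_of_symmetric (fun x hx y hy => ?_) (fun x hx => ?_) f
  · rw [polar_comm, mem_sup_span_singleton_comm (mem_residue.mp hy).2 (mem_residue.mp hx).2]
  · rw [← residue_sup_span_singleton, hQ _ a (hU.sup_span_residue hx)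
      (by rw [finrank_sup_span_residue hx]; omega), finrank_sup_span_residue hx]

open Classical in
theorem sum_residue_eq_of_sum_residue_sup_span [CharZero K] (hQ : HasResidueCounts Q n t)
    (hU : TotallySingular Q U) {a : ℕ} (hn : Module.finrank F U + (a + 1) = n)
    (hf : ∀ y ∈ residue Q U, ∑ x ∈ residue Q (U ⊔ Submodule.span F {y}), f x =
      ((Fintype.card F : K) ^ a * t + 1) *
        (μ - ∑ x with x ∈ U ⊔ Submodule.span F {y}, f x)) :
    ∑ x ∈ residue Q U, f x =
      ((Fintype.card F : K) ^ (a + 1) * t + 1) * (μ - ∑ x with x ∈ U, f x) := by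
  set q : ℕ := Fintype.card F with hq
  set j := Module.finrank F U with hj
  set R := ∑ x ∈ residue Q U, f x with hR
  set I := ∑ x with x ∈ U, f x
  have hrec (y : V) (hy : y ∈ residue Q U) :
      ∑ x ∈ residue Q (U ⊔ Submodule.span F {y}), f x = ((q : K) ^ a * t + 1) *
        (μ - I - ∑ x ∈ residue Q U with x ∈ U ⊔ Submodule.span F {y}, f x) := by
    rw [hf y hy, sum_sup_span_residue hU hy]
    ring
  have hcount := hQ.sum_residue_residue hU hn f
  rw [Finset.sum_congr rfl hrec, ← Finset.mul_sum, Finset.sum_sub_distrib, Finset.sum_const,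
    sum_residue_mem_sup hU, hQ U (a + 1) hU hn, ← hq, ← hj, ← hR, nsmul_eq_mul] at hcount
  have hq1 : 1 ≤ q := Fintype.card_pos
  have hpow (i : ℕ) : 1 ≤ q ^ i := Nat.one_le_pow _ _ hq1
  push_cast [Nat.cast_sub (hpow _), Nat.cast_sub hq1] at hcount
  have hne : (q : K) ^ j * ((q : K) ^ (a + 1) - 1) * ((q : K) ^ a * t + 1) ≠ 0 := by
    refine mul_ne_zero (mul_ne_zero ?_ (sub_ne_zero.mpr ?_)) ?_
    · exact_mod_cast (Nat.lt_of_succ_le (hpow j)).ne'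
    · exact_mod_cast (Nat.one_lt_pow a.succ_ne_zero Fintype.one_lt_card).ne'
    · exact_mod_cast Nat.succ_ne_zero (q ^ a * t)
  refine mul_left_cancel₀ hne ?_
  linear_combination -hcount

open Classical in
theorem sum_residue_eq [CharZero K] (hQ : HasResidueCounts Q n t)
    (hf : ∀ W, IsGenerator Q W → ∑ x with x ∈ W, f x = μ) {a : ℕ} :
    ∀ U, TotallySingular Q U → Module.finrank F U + a = n →
      ∑ x ∈ residue Q U, f x =
        ((Fintype.card F : K) ^ a * t + 1) * (μ - ∑ x with x ∈ U, f x) := by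
  induction a with
  | zero =>
    intro U hU hn
    have hempty := hQ.residue_eq_empty hU hn
    rw [hempty, hf U (isGenerator_of_residue_eq_empty hU hempty)]
    simp
  | succ a ih =>
    intro U hU hn
    refine hQ.sum_residue_eq_of_sum_residue_sup_span hU hn fun y hy => ?_
    exact ih _ (hU.sup_span_residue hy) (by rw [finrank_sup_span_residue hy]; omega)

end HasResidueCounts

end PolarSpace

section OvoidFourier

open QuadraticMap

variable {F V : Type*} [Field F] [AddCommGroup V] [Module F V] [Fintype V]
  {Q : QuadraticForm F V} {U : Submodule F V}

open Classical in
theorem sum_polarPerp_singular_eq_sum_residue_add {K : Type*} [AddCommMonoid K]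
    (hU : TotallySingular Q U) (f : V → K) :
    ∑ x with x ∈ polarPerp Q U ∧ Q x = 0, f x = ∑ x ∈ residue Q U, f x + ∑ x with x ∈ U, f x := by
  have hfilter : (Finset.univ.filter fun x => (x ∈ polarPerp Q U ∧ Q x = 0) ∧ x ∈ U) =
      Finset.univ.filter (· ∈ U) :=
    Finset.filter_congr fun x _ => ⟨And.right, fun h => ⟨⟨hU.le_polarPerp h, hU x h⟩, h⟩⟩
  rw [← Finset.sum_filter_add_sum_filter_not _ (· ∈ U), Finset.filter_filter,
    Finset.filter_filter, hfilter, add_comm, residue]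

open Classical in
theorem sum_polarPerp_eq_sum_residue_add {K : Type*} [AddCommMonoid K] {f : V → K}
    (hf : ∀ x, Q x ≠ 0 → f x = 0) (hU : TotallySingular Q U) :
    ∑ x with x ∈ polarPerp Q U, f x = ∑ x ∈ residue Q U, f x + ∑ x with x ∈ U, f x := by
  rw [← sum_polarPerp_singular_eq_sum_residue_add hU, ← Finset.filter_filter]
  exact (Finset.sum_filter_of_ne fun x _ hx => not_imp_comm.mp (hf x) hx).symm

variable [Fintype F]

theorem HasMinusGaussSums.hasResidueCounts {ψ : AddChar F ℂ} {n : ℕ}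
    (hQ : HasMinusGaussSums Q ψ (n + 1)) (hψ : ψ ≠ 1) : HasResidueCounts Q n (Fintype.card F) := by
  classical
  rintro U a hU hn
  have hcount := hQ.card_mul_card_polarPerp_singular hψ hU
  rw [Module.card_eq_pow_finrank (K := F) (V := polarPerp Q U),
    Finset.card_eq_sum_ones, sum_polarPerp_singular_eq_sum_residue_add hU,
    ← Finset.card_eq_sum_ones, ← Finset.card_eq_sum_ones, card_filter_mem_submodule,
    show Module.finrank F (polarPerp Q U) = Module.finrank F U + 2 * a + 2 by
      have := hQ.finrank_polarPerp_add hψ U; omega, ← hn] at hcount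
  have hq : (Fintype.card F : ℂ) ≠ 0 := Nat.cast_ne_zero.mpr Fintype.card_ne_zero
  have hpow : 1 ≤ Fintype.card F ^ a := Nat.one_le_pow _ _ Fintype.card_pos
  apply Nat.cast_injective (R := ℂ)
  apply mul_left_cancel₀ hq
  push_cast [Nat.cast_sub hpow] at hcount ⊢
  linear_combination hcount

open Classical in
theorem sum_span_singleton_of_homogeneous {K : Type*} [NonAssocSemiring K] {f : V → K}
    (hf : ∀ (c : F) x, c ≠ 0 → f (c • x) = f x) {v : V} (hv : v ≠ 0) :
    ∑ x with x ∈ Submodule.span F {v}, f x = f 0 + (Fintype.card F - 1 : ℕ) * f v := by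
  have himage : Finset.univ.filter (· ∈ Submodule.span F {v}) =
      Finset.univ.image fun c : F => c • v := by
    ext x
    simp [Submodule.mem_span_singleton]
  rw [himage, Finset.sum_image fun c _ d _ h => smul_left_injective F hv h,
    ← Finset.add_sum_erase _ _ (Finset.mem_univ 0), zero_smul,
    Finset.sum_congr rfl fun c hc => hf c v (Finset.ne_of_mem_erase hc), Finset.sum_const,
    Finset.card_erase_of_mem (Finset.mem_univ _), Finset.card_univ, nsmul_eq_mul]

open Classical in
theorem sum_mul_addChar_polar_of_homogeneous {ψ : AddChar F ℂ} (hψ : ψ ≠ 1) {f : V → ℂ}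
    (hf : ∀ (c : F) x, c ≠ 0 → f (c • x) = f x) (v : V) :
    (Fintype.card F - 1) * ∑ x, f x * ψ (polar Q v x) =
      Fintype.card F * ∑ x with x ∈ polarPerp Q (Submodule.span F {v}), f x - ∑ x, f x := by
  have hscale (c : F) (hc : c ∈ Finset.univ.erase 0) :
      ∑ x, f x * ψ (c * polar Q v x) = ∑ x, f x * ψ (polar Q v x) := by
    have hc0 := Finset.ne_of_mem_erase hc
    rw [← Equiv.sum_comp (LinearEquiv.smulOfNeZero F V c hc0).toEquiv
      fun x => f x * ψ (polar Q v x)]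
    refine Finset.sum_congr rfl fun x _ => ?_
    simp [hf c x hc0, polar_smul_right]
  have hmem (x : V) : x ∈ polarPerp Q (Submodule.span F {v}) ↔ polar Q v x = 0 := by
    rw [← bot_sup_eq (Submodule.span F {v}), mem_polarPerp_sup_span_singleton]
    simp [mem_polarPerp]
  have hall : ∑ c, ∑ x, f x * ψ (c * polar Q v x) =
      Fintype.card F * ∑ x with x ∈ polarPerp Q (Submodule.span F {v}), f x := by
    rw [Finset.sum_comm]
    simp [← Finset.mul_sum, sum_addChar_mul_eq_ite hψ, hmem, ← Finset.sum_filter,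
      ← Finset.sum_mul, mul_comm]
  rw [← hall, ← Finset.add_sum_erase _ _ (Finset.mem_univ (0 : F)), Finset.sum_congr rfl hscale,
    Finset.sum_const, Finset.card_erase_of_mem (Finset.mem_univ _), Finset.card_univ,
    nsmul_eq_mul, Nat.cast_pred Fintype.card_pos]
  simp

open Classical in
theorem HasResidueCounts.sum_mul_addChar_polar {n t : ℕ} (hQ : HasResidueCounts Q (n + 1) t)
    {ψ : AddChar F ℂ} (hψ : ψ ≠ 1) {f : V → ℂ} {μ : ℂ}
    (hμ : ∀ W, IsGenerator Q W → ∑ x with x ∈ W, f x = μ)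
    (hf : ∀ (c : F) x, c ≠ 0 → f (c • x) = f x) (hf0 : f 0 = 0) (hsing : ∀ x, Q x ≠ 0 → f x = 0)
    {v : V} (hv : v ≠ 0) (hQv : Q v = 0) :
    ∑ x, f x * ψ (polar Q v x) = μ - Fintype.card F ^ (n + 1) * t * f v := by
  have hperp {U : Submodule F V} {a : ℕ} (hU : TotallySingular Q U)
      (hn : Module.finrank F U + a = n + 1) : ∑ x with x ∈ polarPerp Q U, f x =
        ((Fintype.card F : ℂ) ^ a * t + 1) * (μ - ∑ x with x ∈ U, f x) + ∑ x with x ∈ U, f x := by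
    rw [sum_polarPerp_eq_sum_residue_add hsing hU, hQ.sum_residue_eq hμ U hU hn]
  have htotal : ∑ x, f x = ((Fintype.card F : ℂ) ^ (n + 1) * t + 1) * μ := by
    have hbot : TotallySingular Q (⊥ : Submodule F V) := by
      rintro w rfl
      exact QuadraticMap.map_zero Q
    simpa [mem_polarPerp, Finset.sum_filter, hf0] using hperp hbot (a := n + 1) (by simp)
  have hspan : TotallySingular Q (Submodule.span F {v}) := by
    rintro w hw
    obtain ⟨c, rfl⟩ := Submodule.mem_span_singleton.mp hw
    rw [QuadraticMap.map_smul, hQv, smul_zero]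
  have hline := hperp hspan (a := n) (by rw [finrank_span_singleton hv, add_comm])
  rw [sum_span_singleton_of_homogeneous hf hv, hf0, zero_add, Nat.cast_pred Fintype.card_pos]
    at hline
  have hne : (Fintype.card F : ℂ) - 1 ≠ 0 :=
    sub_ne_zero.mpr (by exact_mod_cast (Fintype.one_lt_card (α := F)).ne')
  refine mul_left_cancel₀ hne ?_
  rw [sum_mul_addChar_polar_of_homogeneous hψ hf, hline, htotal]
  ring

end OvoidFourier

section EllipticForm

section Field

open Polynomial

variable {E : Type*} [Field E]

theorem ellipticForm_zero_apply (a₀ a₁ : E) (x : Fin 2 → E) :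
    ellipticForm E 0 a₀ a₁ x = x 0 ^ 2 + a₀ * x 0 * x 1 + a₁ * x 1 ^ 2 := by
  simp [ellipticForm_apply]

theorem ellipticForm_succ_apply (k : ℕ) (a₀ a₁ x z : E) (w : Fin (2 * k + 2) → E) :
    ellipticForm E (k + 1) a₀ a₁ (Fin.cons x (Fin.cons z w : Fin (2 * k + 2 + 1) → E)) =
      x * z + ellipticForm E k a₀ a₁ w := by
  rw [ellipticForm_apply, ellipticForm_apply, Fin.sum_univ_succ]
  simp only [add_assoc]
  rfl

theorem exists_ellipticForm_succ_eq (k : ℕ) (a₀ a₁ u : E) :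
    ∃ v, ellipticForm E (k + 1) a₀ a₁ v = u :=
  ⟨Fin.cons 1 (Fin.cons u (0 : Fin (2 * k + 2) → E) : Fin (2 * k + 2 + 1) → E), by
    rw [ellipticForm_succ_apply, QuadraticMap.map_zero, one_mul, add_zero]⟩

theorem sq_ne_of_irreducible {a₀ a₁ : E} (hirr : Irreducible (X ^ 2 + C a₀ * X + C a₁ : E[X]))
    (r : E) : r ^ 2 ≠ -a₁ + a₀ * r := by
  intro hr
  have hroot : (X ^ 2 + C a₀ * X + C a₁ : E[X]).IsRoot (-r) := by
    simp only [IsRoot.def, eval_add, eval_pow, eval_mul, eval_X, eval_C]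
    linear_combination hr
  have hone := degree_eq_one_of_irreducible_of_root hirr hroot
  have htwo : (X ^ 2 + C a₀ * X + C a₁ : E[X]).degree = 2 := by compute_degree!
  exact absurd (htwo.symm.trans hone) (by decide)

variable [Fintype E]

theorem sum_addChar_mul_mul {ψ : AddChar E ℂ} (hψ : ψ ≠ 1) {c : E} (hc : c ≠ 0) :
    ∑ x, ∑ y, ψ (c * (x * y)) = Fintype.card E := by
  classical
  simp_rw [← mul_assoc, mul_comm _ (_ : E), sum_addChar_mul_eq_ite hψ]
  simp [hc]

theorem sum_addChar_mul_norm {L : Type*} [Field L] [Fintype L] [Algebra E L]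
    (h : Module.finrank E L = 2) {ψ : AddChar E ℂ} (hψ : ψ ≠ 1) {c : E} (hc : c ≠ 0) :
    ∑ z : L, ψ (c * Algebra.norm E z) = -Fintype.card E := by
  classical
  have hpairs := sum_add_mul_add_sum_trace_norm h fun _ p => ψ (c * p)
  have hzero : ∑ p, ψ (c * p) = 0 := by
    simp_rw [mul_comm c, sum_addChar_mul_eq_ite hψ, if_neg hc]
  rw [sum_addChar_mul_mul hψ hc, hzero, Finset.sum_const_zero, smul_zero] at hpairs
  exact eq_neg_of_add_eq_zero_right hpairs

theorem sum_addChar_mul_ellipticForm_zero {a₀ a₁ : E}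
    (hirr : Irreducible (X ^ 2 + C a₀ * X + C a₁ : E[X])) {ψ : AddChar E ℂ} (hψ : ψ ≠ 1) {c : E}
    (hc : c ≠ 0) :
    ∑ x, ψ (c * ellipticForm E 0 a₀ a₁ x) = -Fintype.card E := by
  have : Fact (∀ r : E, r ^ 2 ≠ -a₁ + a₀ * r) := ⟨sq_ne_of_irreducible hirr⟩
  let L := QuadraticAlgebra E (-a₁) a₀
  let coord : L ≃ₗ[E] (Fin 2 → E) := QuadraticAlgebra.linearEquivTuple (-a₁) a₀
  have : Fintype L := Fintype.ofEquiv _ coord.symm.toEquiv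
  have hnorm (z : L) : ellipticForm E 0 a₀ a₁ (coord z) = Algebra.norm E z := by
    have hdet : Algebra.norm E z = z.norm := QuadraticAlgebra.det_toLinearMap_eq_norm z
    have hre : coord z 0 = z.re := rfl
    have him : coord z 1 = z.im := rfl
    rw [ellipticForm_zero_apply, hdet, QuadraticAlgebra.norm_def, hre, him]
    ring
  rw [← coord.toEquiv.sum_comp]
  simp only [LinearEquiv.coe_toEquiv, hnorm]
  exact sum_addChar_mul_norm (QuadraticAlgebra.finrank_eq_two (-a₁) a₀) hψ hc

theorem sum_addChar_mul_ellipticForm_succ {ψ : AddChar E ℂ} (hψ : ψ ≠ 1) (k : ℕ) (a₀ a₁ : E)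
    {c : E} (hc : c ≠ 0) :
    ∑ w, ψ (c * ellipticForm E (k + 1) a₀ a₁ w) =
      Fintype.card E * ∑ w, ψ (c * ellipticForm E k a₀ a₁ w) := by
  have hplane (x : E) : ∑ v : Fin (2 * k + 2 + 1) → E,
      ψ (c * ellipticForm E (k + 1) a₀ a₁ (Fin.cons x v)) =
        (∑ z, ψ (c * (x * z))) * ∑ w, ψ (c * ellipticForm E k a₀ a₁ w) := by
    rw [← (Fin.consEquiv fun _ : Fin (2 * k + 2 + 1) => E).sum_comp, Fintype.sum_prod_type,
      Finset.sum_mul_sum]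
    refine Finset.sum_congr rfl fun z _ => Finset.sum_congr rfl fun w _ => ?_
    rw [← AddChar.map_add_eq_mul, ← mul_add, ← ellipticForm_succ_apply]
    rfl
  rw [← sum_addChar_mul_mul hψ hc, Finset.sum_mul, ← Finset.sum_congr rfl fun x _ => hplane x,
    ← Fintype.sum_prod_type']
  exact ((Fin.consEquiv fun _ : Fin (2 * k + 2 + 1 + 1) => E).sum_comp _).symm

theorem hasMinusGaussSums_ellipticForm {a₀ a₁ : E}
    (hirr : Irreducible (X ^ 2 + C a₀ * X + C a₁ : E[X])) {ψ : AddChar E ℂ} (hψ : ψ ≠ 1) (k : ℕ) :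
    HasMinusGaussSums (ellipticForm E k a₀ a₁) ψ (k + 1) := by
  refine ⟨by rw [Fintype.card_fun, Fintype.card_fin, Nat.mul_succ], fun c hc => ?_⟩
  induction k with
  | zero => rw [sum_addChar_mul_ellipticForm_zero hirr hψ hc, zero_add, pow_one]
  | succ k ih => rw [sum_addChar_mul_ellipticForm_succ hψ k a₀ a₁ hc, ih, pow_succ']; ring

end Field

section TraceForm

open QuadraticMap

variable {F E V : Type*} [Field F] [Field E] [Algebra F E] [AddCommGroup V] [Module E V]
  [Module F V] [IsScalarTower F E V]

theorem polar_traceForm (Q : QuadraticForm E V) (v w : V) :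
    polar (traceForm F Q) v w = Algebra.trace F E (polar Q v w) := by
  simp [polar, traceForm_apply]

variable [Fintype F] [Fintype E] [Fintype V]

theorem HasMinusGaussSums.traceForm {Q : QuadraticForm E V} {ψ : AddChar F ℂ} {N : ℕ}
    (hQ : HasMinusGaussSums Q (traceLift E ψ) N) :
    HasMinusGaussSums (traceForm F Q) ψ (Module.finrank F E * N) := by
  have hcard : Fintype.card E = Fintype.card F ^ Module.finrank F E := Module.card_eq_pow_finrank
  refine ⟨by rw [hQ.1, hcard, ← pow_mul]; congr 1; ring, fun c hc => ?_⟩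
  have hsum := hQ.2 (algebraMap F E c) ((map_ne_zero _).mpr hc)
  rw [hcard, Nat.cast_pow, ← pow_mul] at hsum
  rw [← hsum]
  refine Finset.sum_congr rfl fun w _ => ?_
  rw [traceLift_apply, traceForm_apply, ← Algebra.smul_def, map_smul, smul_eq_mul]

end TraceForm

section Quadric

open QuadraticMap

variable {E V : Type*} [Field E] [Fintype E] [AddCommGroup V] [Module E V] [Fintype V]

open Classical in
theorem sum_sum_addChar_mul_add_polar {ψ : AddChar E ℂ} (hψ : ψ ≠ 1) (Q : QuadraticForm E V)
    (v : V) (c : E) :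
    ∑ y, ψ (-(y * c)) * ∑ w, ψ (y * Q w + polar Q v w) =
      Fintype.card E * ∑ w with Q w = c, ψ (polar Q v w) := by
  have hterm (y : E) (w : V) : ψ (-(y * c)) * ψ (y * Q w + polar Q v w) =
      ψ (y * (Q w - c)) * ψ (polar Q v w) := by
    rw [← AddChar.map_add_eq_mul, ← AddChar.map_add_eq_mul]
    congr 1
    ring
  simp_rw [Finset.mul_sum, hterm]
  rw [Finset.sum_comm]
  simp_rw [← Finset.sum_mul, sum_addChar_mul_eq_ite hψ, sub_eq_zero, ite_mul, zero_mul,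
    ← Finset.sum_filter]

open Classical in
theorem HasMinusGaussSums.card_mul_sum_quadric_addChar_polar {Q : QuadraticForm E V}
    {ψ : AddChar E ℂ} {N : ℕ} (hQ : HasMinusGaussSums Q ψ N) (hψ : ψ ≠ 1)
    {v : V} (hv : v ≠ 0) {c : E} (hc : c ≠ 0) :
    Fintype.card E * ∑ w with Q w = c, ψ (polar Q v w) =
      -(Fintype.card E : ℂ) ^ N * kloosterman ψ (Q v * c) := by
  have hv0 : ∑ w, ψ (polar Q v w) = 0 :=
    (sum_addChar_linearMap_eq_ite hψ (Q.polarBilin v)).trans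
      (if_neg (hQ.polarBilin_ne_zero hψ hv))
  rw [← sum_sum_addChar_mul_add_polar hψ, kloosterman_eq_sum_ite,
    ← ((Equiv.mulRight₀ c hc).trans (Equiv.neg E)).sum_comp
      fun x => if x = 0 then 0 else ψ (x + Q v * c / x), Finset.mul_sum]
  refine Finset.sum_congr rfl fun y _ => ?_
  rw [Equiv.trans_apply, Equiv.neg_apply, Equiv.mulRight₀_apply]
  rcases eq_or_ne y 0 with rfl | hy
  · simp [hv0]
  · have hsub : -(y * c) + Q v * c / -(y * c) = -(y * c) + -(Q v / y) := by field_simp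
    rw [if_neg (neg_ne_zero.mpr (mul_ne_zero hy hc)), sum_addChar_mul_add_polar Q ψ hy,
      hQ.2 y hy, hsub, AddChar.map_add_eq_mul]
    ring

end Quadric

end EllipticForm

section SquareCosets

open Classical in
theorem two_mul_card_nonzeroSquares_le {F : Type*} [Field F] [Fintype F] (hF : ringChar F ≠ 2) :
    2 * (Finset.univ.filter fun c : F => c ∈ nonzeroSquares F).card ≤ Fintype.card Fˣ := by
  have hfiber (s : F) (hs : s ∈ Finset.univ.filter fun c : F => c ∈ nonzeroSquares F) :
      2 ≤ (Finset.univ.filter fun u : Fˣ => (u : F) ^ 2 = s).card := by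
    obtain ⟨hs0, r, rfl⟩ := (Finset.mem_filter_univ s).mp hs
    let u := Units.mk0 r (left_ne_zero_of_mul hs0)
    have hne : u ≠ -u := fun h =>
      u.ne_zero ((Ring.eq_self_iff_eq_zero_of_char_ne_two hF).mp (congrArg Units.val h).symm)
    refine (Finset.card_pair hne).ge.trans (Finset.card_le_card fun w hw => ?_)
    rcases Finset.mem_insert.mp hw with rfl | hw
    · simp [u, sq]
    · simp [Finset.mem_singleton.mp hw, u, sq]
  have hmaps : ∀ u ∈ (Finset.univ : Finset Fˣ),
      (u : F) ^ 2 ∈ Finset.univ.filter fun c : F => c ∈ nonzeroSquares F := fun u _ =>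
    (Finset.mem_filter_univ _).mpr ⟨pow_ne_zero 2 u.ne_zero, u, sq _⟩
  have hsum := Finset.card_nsmul_le_sum _ _ 2 hfiber
  rwa [← Finset.card_eq_sum_card_fiberwise hmaps, Finset.card_univ, smul_eq_mul, mul_comm] at hsum

open Classical in
theorem card_nonzeroSquares_le (F : Type*) [Field F] [Fintype F] :
    ((Finset.univ.filter fun c : F => c ∈ nonzeroSquares F).card : ℝ) ≤
      parityFactor (Fintype.card F) * ((Fintype.card F : ℝ) - 1) := by
  have hunits : ((Fintype.card Fˣ : ℕ) : ℝ) = Fintype.card F - 1 := by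
    rw [Fintype.card_units, Nat.cast_pred Fintype.card_pos]
  rw [← hunits, parityFactor]
  split_ifs with hodd
  · have hchar : ringChar F ≠ 2 := fun h =>
      Nat.not_odd_iff.mpr (FiniteField.even_card_of_char_two h) hodd
    have htwo := two_mul_card_nonzeroSquares_le hchar
    rify at htwo
    linarith
  · rw [one_mul, Nat.cast_le, ← Finset.card_univ]
    refine Finset.card_le_card_of_surjOn Units.val fun c hc => ?_
    exact ⟨Units.mk0 c ((Finset.mem_filter_univ c).mp hc).1, by simp⟩

open Classical in
theorem IsSquareCosetReps.card_le {F E : Type*} [Field F] [Fintype F] [Field E] [Fintype E]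
    [Algebra F E] {S : Set E} {T : Finset E} (hT : IsSquareCosetReps F S T) :
    ((Finset.univ.filter (· ∈ S)).card : ℝ) ≤
      parityFactor (Fintype.card F) * ((Fintype.card F : ℝ) - 1) * T.card := by
  have hcover : Finset.univ.filter (· ∈ S) ⊆
      Finset.image₂ (· • ·) (Finset.univ.filter fun c : F => c ∈ nonzeroSquares F) T := by
    intro x hx
    obtain ⟨t, ⟨ht, c, hc, rfl⟩, -⟩ := hT.2 x ((Finset.mem_filter_univ x).mp hx)
    exact Finset.mem_image₂_of_mem ((Finset.mem_filter_univ c).mpr hc) ht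
  refine le_trans ?_ (mul_le_mul_of_nonneg_right (card_nonzeroSquares_le F) (Nat.cast_nonneg _))
  exact_mod_cast (Finset.card_le_card hcover).trans (Finset.card_image₂_le _ _ _)

end SquareCosets

section Points

variable {F V : Type*} [Field F] [Fintype F] [AddCommGroup V] [Module F V]

open Classical in
theorem card_eq_card_units_mul_card_image_span {X : Finset V} (h0 : (0 : V) ∉ X)
    (hX : ∀ c : F, c ≠ 0 → ∀ x ∈ X, c • x ∈ X) :
    X.card = Fintype.card Fˣ * (X.image fun x => Submodule.span F {x}).card := by
  rw [Finset.card_eq_sum_card_image fun x => Submodule.span F {x}, mul_comm]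
  refine Finset.sum_const_nat fun P hP => ?_
  obtain ⟨v, hv, rfl⟩ := Finset.mem_image.mp hP
  have hline : (X.filter fun x => Submodule.span F {x} = Submodule.span F {v}) =
      Finset.univ.image fun c : Fˣ => (c : F) • v := by
    ext x
    rw [Finset.mem_filter, eq_comm, Submodule.span_singleton_eq_span_singleton]
    simp only [Finset.mem_image, Finset.mem_univ, true_and]
    refine ⟨And.right, ?_⟩
    rintro ⟨c, rfl⟩
    exact ⟨hX c c.ne_zero v hv, c, rfl⟩
  rw [hline, Finset.card_image_of_injective _ fun c c' h => Units.ext <|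
    smul_left_injective F (ne_of_mem_of_not_mem hv h0) h, Finset.card_univ]

variable {E : Type*} [Field E] [Algebra F E] [Module E V] [IsScalarTower F E V] [Fintype V]

open Classical in
theorem IsMOvoid.card_filter_mem {Q : QuadraticForm F V} {Q' : QuadraticForm E V} {S : Set E}
    (hS0 : (0 : E) ∉ S) (hSinv : ∀ c ∈ nonzeroSquares F, ∀ x ∈ S, c • x ∈ S) {m : ℕ}
    (hM : IsMOvoid Q m (pointsWithValueIn F Q' S)) {W : Submodule F V} (hW : IsGenerator Q W) :
    (Finset.univ.filter fun x => Q' x ∈ S ∧ x ∈ W).card = Fintype.card Fˣ * m := by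
  have h0 : (0 : V) ∉ Finset.univ.filter fun x => Q' x ∈ S ∧ x ∈ W := by
    simp [hS0]
  rw [card_eq_card_units_mul_card_image_span (F := F) h0 fun c hc x hx => ?_]
  · congr 1
    rw [← ENat.natCast_inj, ← hM.2 W hW, ← Set.encard_coe_eq_coe_finsetCard]
    congr 1
    ext P
    simp only [Finset.coe_image, Finset.coe_filter, Finset.mem_univ, true_and, Set.mem_image]
    constructor
    · rintro ⟨v, ⟨hv, hvW⟩, rfl⟩
      refine ⟨⟨v, ?_, hv, rfl⟩, (Submodule.span_singleton_le_iff_mem v W).mpr hvW⟩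
      rintro rfl
      simp [hS0] at hv
    · rintro ⟨⟨v, -, hv, rfl⟩, hvW⟩
      exact ⟨v, ⟨hv, (Submodule.span_singleton_le_iff_mem v W).mp hvW⟩, rfl⟩
  · rw [Finset.mem_filter_univ] at hx ⊢
    rw [QuadraticMap.map_smul_of_tower]
    exact ⟨hSinv _ ⟨mul_ne_zero hc hc, c, rfl⟩ _ hx.1, W.smul_mem c hx.2⟩

end Points

section OvoidBound

open QuadraticMap

section QuadricUnion

variable {E V : Type*} [Field E] [Fintype E] [AddCommGroup V] [Module E V] [Fintype V]
  {Q : QuadraticForm E V} {ψ : AddChar E ℂ} {k : ℕ} {S : Set E} {v : V}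

open Classical in
theorem HasMinusGaussSums.sum_mem_addChar_polar (hQ : HasMinusGaussSums Q ψ (k + 1)) (hψ : ψ ≠ 1)
    (hS0 : (0 : E) ∉ S) (hv : v ≠ 0) :
    ∑ x with Q x ∈ S, ψ (polar Q v x) =
      -(Fintype.card E : ℂ) ^ k * ∑ c with c ∈ S, kloosterman ψ (Q v * c) := by
  have hE : (Fintype.card E : ℂ) ≠ 0 := Nat.cast_ne_zero.mpr Fintype.card_ne_zero
  have hfiber : ∑ c with c ∈ S, ∑ x with Q x = c, ψ (polar Q v x) =
      ∑ x with Q x ∈ S, ψ (polar Q v x) := by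
    rw [Finset.sum_comm' (s' := fun x => {Q x}) (t' := Finset.univ.filter (Q · ∈ S)) (by aesop)]
    simp only [Finset.sum_singleton]
  refine mul_left_cancel₀ hE ?_
  rw [← hfiber, Finset.mul_sum, ← mul_assoc, mul_neg, ← pow_succ', Finset.mul_sum]
  refine Finset.sum_congr rfl fun c hc => ?_
  have hc0 : c ≠ 0 := ne_of_mem_of_not_mem ((Finset.mem_filter_univ c).mp hc) hS0
  exact hQ.card_mul_sum_quadric_addChar_polar hψ hv hc0

open Classical in
theorem HasMinusGaussSums.norm_sum_mem_addChar_polar_le (hQ : HasMinusGaussSums Q ψ (k + 1))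
    (hψ : ψ ≠ 1) (hS0 : (0 : E) ∉ S) (hv : Q v ≠ 0) :
    ‖∑ x with Q x ∈ S, ψ (polar Q v x)‖ ≤ (Fintype.card E : ℝ) ^ k *
      ((Finset.univ.filter (· ∈ S)).card * (2 * √(Fintype.card E : ℝ))) := by
  have hv0 : v ≠ 0 := by
    rintro rfl
    exact hv (QuadraticMap.map_zero Q)
  rw [hQ.sum_mem_addChar_polar hψ hS0 hv0, norm_mul, norm_neg, norm_pow, Complex.norm_natCast,
    ← nsmul_eq_mul (Finset.card _)]
  gcongr
  refine norm_sum_le_of_le _ (f := fun c => kloosterman ψ (Q v * c)) (fun c hc => ?_) |>.trans_eq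
    (Finset.sum_const _)
  have hc0 : c ≠ 0 := ne_of_mem_of_not_mem ((Finset.mem_filter_univ c).mp hc) hS0
  exact norm_kloosterman_le hψ (mul_ne_zero hv hc0)

end QuadricUnion

variable {F E V : Type*} [Field F] [Fintype F] [Field E] [Fintype E] [Algebra F E]
  [AddCommGroup V] [Module E V] [Module F V] [IsScalarTower F E V] [Fintype V]
  {Q : QuadraticForm E V} {ψ : AddChar F ℂ} {k m : ℕ} {S : Set E} {v : V}

open Classical in
theorem IsMOvoid.sum_mem_addChar_polar (hQ : HasMinusGaussSums Q (traceLift E ψ) (k + 1))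
    (hψ : ψ ≠ 1) (hk : 2 ≤ Module.finrank F E * (k + 1)) (hS0 : (0 : E) ∉ S)
    (hSinv : ∀ c ∈ nonzeroSquares F, ∀ x ∈ S, c • x ∈ S)
    (hStr : ∀ x ∈ S, Algebra.trace F E x = 0)
    (hM : IsMOvoid (traceForm F Q) m (pointsWithValueIn F Q S)) (hv : Q v ∈ S) :
    ∑ x with Q x ∈ S, traceLift E ψ (polar Q v x) =
      Fintype.card Fˣ * m - (Fintype.card E : ℂ) ^ (k + 1) := by
  obtain ⟨n, hn⟩ := Nat.exists_eq_add_of_le' hk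
  have hcounts := (hn ▸ hQ.traceForm).hasResidueCounts hψ
  have hv0 : v ≠ 0 := by
    rintro rfl
    exact hS0 (QuadraticMap.map_zero Q ▸ hv)
  have hfourier := hcounts.sum_mul_addChar_polar hψ (f := fun x => if Q x ∈ S then 1 else 0)
    (μ := Fintype.card Fˣ * m) (fun W hW => ?_) (fun c x hc => ?_) (by simp [hS0])
    (fun x hx => if_neg fun hxS => hx (hStr _ hxS)) hv0 (hStr _ hv)
  · have hcard : (Fintype.card E : ℂ) ^ (k + 1) = Fintype.card F ^ (n + 1) * Fintype.card F := by
      rw [Module.card_eq_pow_finrank (K := F) (V := E), Nat.cast_pow, ← pow_mul, hn, pow_succ]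
    simpa [hcard, hv, Finset.sum_ite, polar_traceForm, traceLift_apply] using hfourier
  · rw [Finset.sum_boole, Finset.filter_filter, ← Nat.cast_mul, ← hM.card_filter_mem hS0 hSinv hW]
    simp only [and_comm]
  · have hiff : Q (c • x) ∈ S ↔ Q x ∈ S := by
      have hsquare (a : F) (y : V) (ha : a ≠ 0) (hy : Q y ∈ S) : Q (a • y) ∈ S := by
        rw [QuadraticMap.map_smul_of_tower]
        exact hSinv _ ⟨mul_ne_zero ha ha, a, rfl⟩ _ hy
      refine ⟨fun h => ?_, hsquare c x hc⟩
      simpa [smul_smul, hc] using hsquare c⁻¹ _ (inv_ne_zero hc) h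
    simp only [hiff]

open Classical in
theorem IsMOvoid.card_pow_succ_le (hψ : ψ ≠ 1)
    (hQ : HasMinusGaussSums Q (traceLift E ψ) (k + 1))
    (hk : 2 ≤ Module.finrank F E * (k + 1)) (hS0 : (0 : E) ∉ S)
    (hSinv : ∀ c ∈ nonzeroSquares F, ∀ x ∈ S, c • x ∈ S)
    (hStr : ∀ x ∈ S, Algebra.trace F E x = 0)
    (hM : IsMOvoid (traceForm F Q) m (pointsWithValueIn F Q S)) (hv : Q v ∈ S) :
    (Fintype.card E : ℝ) ^ (k + 1) ≤ Fintype.card Fˣ * m + (Fintype.card E : ℝ) ^ k *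
      ((Finset.univ.filter (· ∈ S)).card * (2 * √(Fintype.card E : ℝ))) := by
  have hnorm := hQ.norm_sum_mem_addChar_polar_le (traceLift_ne_one hψ) hS0
    (ne_of_mem_of_not_mem hv hS0)
  rw [hM.sum_mem_addChar_polar hQ hψ hk hS0 hSinv hStr hv, norm_sub_rev] at hnorm
  have hreal : ((Fintype.card E : ℂ) ^ (k + 1) - Fintype.card Fˣ * m) =
      (((Fintype.card E : ℝ) ^ (k + 1) - Fintype.card Fˣ * m : ℝ) : ℂ) := by push_cast; rfl
  rw [hreal, Complex.norm_real] at hnorm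
  exact sub_le_iff_le_add'.mp ((Real.le_norm_self _).trans hnorm)

theorem parityFactor_nonneg (q : ℕ) : 0 ≤ parityFactor q := by
  rw [parityFactor]
  split_ifs <;> norm_num

theorem IsMOvoid.le_card_reps (hQ : ∀ ψ : AddChar E ℂ, ψ ≠ 1 → HasMinusGaussSums Q ψ (k + 1))
    (hk : 2 ≤ Module.finrank F E * (k + 1)) (hS0 : (0 : E) ∉ S)
    (hSinv : ∀ c ∈ nonzeroSquares F, ∀ x ∈ S, c • x ∈ S)
    (hStr : ∀ x ∈ S, Algebra.trace F E x = 0)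
    (hM : IsMOvoid (traceForm F Q) m (pointsWithValueIn F Q S)) (hv : Q v ∈ S)
    {T : Finset E} (hT : IsSquareCosetReps F S T)
    (hm : (m : ℝ) = parityFactor (Fintype.card F) * T.card * (Fintype.card E : ℝ) ^ k) :
    (Fintype.card E : ℝ) / (parityFactor (Fintype.card F) * ((Fintype.card F : ℝ) - 1) *
      (2 * √(Fintype.card E : ℝ) + 1)) ≤ T.card := by
  classical
  obtain ⟨ψ, hψ⟩ := AddChar.exists_apply_ne_zero.mpr (one_ne_zero (α := F))
  have hψ1 : ψ ≠ 1 := AddChar.ne_one_iff.mpr ⟨1, hψ⟩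
  have hE : 0 < (Fintype.card E : ℝ) ^ k := pow_pos (Nat.cast_pos.mpr Fintype.card_pos) k
  have hunits : ((Fintype.card Fˣ : ℕ) : ℝ) = Fintype.card F - 1 := by
    rw [Fintype.card_units, Nat.cast_pred Fintype.card_pos]
  have hε := parityFactor_nonneg (Fintype.card F)
  rw [← hunits]
  refine div_le_of_le_mul₀ (by positivity) (Nat.cast_nonneg _) (le_of_mul_le_mul_left ?_ hE)
  calc (Fintype.card E : ℝ) ^ k * Fintype.card E
      ≤ Fintype.card Fˣ * m + (Fintype.card E : ℝ) ^ k *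
          ((Finset.univ.filter (· ∈ S)).card * (2 * √(Fintype.card E : ℝ))) := by
        rw [← pow_succ]
        exact hM.card_pow_succ_le hψ1 (hQ _ (traceLift_ne_one hψ1)) hk hS0 hSinv hStr hv
    _ ≤ Fintype.card Fˣ * m + (Fintype.card E : ℝ) ^ k *
          (parityFactor (Fintype.card F) * Fintype.card Fˣ * T.card *
            (2 * √(Fintype.card E : ℝ))) := by
        gcongr
        exact hunits ▸ hT.card_le
    _ = (Fintype.card E : ℝ) ^ k * (T.card * (parityFactor (Fintype.card F) *
          Fintype.card Fˣ * (2 * √(Fintype.card E : ℝ) + 1))) := by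
        rw [hm]
        ring

end OvoidBound

theorem mainTheorem10 {F E : Type*} [Field F] [Fintype F] [Field E] [Fintype E] [Algebra F E]
    (q b d k : ℕ) (hq : Fintype.card F = q) (hb : Module.finrank F E = b)
    (hd : d = b * (2 * k + 2)) (hk : 4 ≤ 2 * k + 2)
    (a₀ a₁ : E)
    (hirr : Irreducible
      (Polynomial.X ^ 2 + Polynomial.C a₀ * Polynomial.X + Polynomial.C a₁ : Polynomial E))
    (S : Set E) (hS0 : ∀ x ∈ S, x ≠ 0)
    (hSinv : ∀ c ∈ nonzeroSquares F, ∀ x ∈ S, c • x ∈ S)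
    (hStr : ∀ x ∈ S, Algebra.trace F E x = 0)
    (T : Finset E) (hT : IsSquareCosetReps F S T) (hTne : T.Nonempty)
    (m : ℕ) (hm : (m : ℝ) = parityFactor q * T.card * (q : ℝ) ^ (d / 2 - b))
    (hM : IsMOvoid (traceForm F (ellipticForm E k a₀ a₁)) m
      (pointsWithValueIn F (ellipticForm E k a₀ a₁) S)) :
    (T.card : ℝ) ≥
      (q : ℝ) ^ b / (parityFactor q * ((q : ℝ) - 1) * (2 * (q : ℝ) ^ ((b : ℝ) / 2) + 1)) := by
  subst hq hb hd
  obtain ⟨k, rfl⟩ := Nat.exists_eq_add_of_le' (by omega : 1 ≤ k)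
  obtain ⟨t, ht⟩ := hTne
  obtain ⟨v, rfl⟩ := exists_ellipticForm_succ_eq k a₀ a₁ t
  have hcard : (Fintype.card E : ℝ) = (Fintype.card F : ℝ) ^ Module.finrank F E := by
    exact_mod_cast Module.card_eq_pow_finrank (K := F) (V := E)
  have hsqrt : √(Fintype.card E : ℝ) =
      (Fintype.card F : ℝ) ^ ((Module.finrank F E : ℝ) / 2) := by
    rw [hcard, Real.sqrt_eq_rpow, ← Real.rpow_natCast_mul (Nat.cast_nonneg _), mul_one_div]
  have hrank : 2 ≤ Module.finrank F E * (k + 1 + 1) :=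
    le_mul_of_one_le_of_le Module.finrank_pos (by omega)
  have hexp : Module.finrank F E * (2 * (k + 1) + 2) / 2 - Module.finrank F E =
      Module.finrank F E * (k + 1) := by
    rw [← mul_add_one 2, mul_left_comm, Nat.mul_div_cancel_left _ two_pos,
      mul_add_one _ (k + 1), Nat.add_sub_cancel]
  rw [hexp, pow_mul, ← hcard] at hm
  rw [← hcard, ← hsqrt]
  exact hM.le_card_reps (fun _ hψ => hasMinusGaussSums_ellipticForm hirr hψ (k + 1)) hrank
    (fun h => hS0 0 h rfl) hSinv hStr (hT.1 ht) hT hm
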